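/- Let $n\ge 0$ and let $V,W$ be finite-dimensional complex inner product spaces, each equipped with a complex conjugation, that is, a conjugate-linear isometric involution $v\mapsto\bar v$ (equivalently, $V=\mathbb{C}\otimes_{\mathbb R}V'$ for a real inner product space $V'$; for instance $V=\mathbb{C}\otimes V'$ with $V'\subset\mathbb{R}^\infty$ finite-dimensional). Equip $\mathbb{C}^{n+1}$ with its standard inner product and coordinatewise conjugation. For complex inner product spaces $A,B$ of finite dimension let $\mathcal{J}^{\mathbf R}(A,B)$ be the space of complex linear isometries $A\to B$ with its topology as a subspace of $\mathrm{Hom}_{\mathbb C}(A,B)$. The group $C_2=\{1,g\}$ acts on $\mathcal{J}^{\mathbf R}(V,W)$ by $(g\cdot f)(v)=\overline{f(\bar v)}$. Let $$S\gamma^{\mathbf R}_{n+1}(V,W)=\{(f,x) : f\in\mathcal{J}^{\mathbf R}(V,W),\ x\in\mathbb{C}^{n+1}\otimes f(V)^{\perp},\ \|x\|=1\}\subset \mathcal{J}^{\mathbf R}(V,W)\times(\mathbb{C}^{n+1}\otimes W)$$ be the unit sphere bundle of the $(n+1)$-st complement bundle, with the diagonal action $g\cdot(f,x)=(g\cdot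 f,\bar x)$, where $\overline{c\otimes w}=\bar c\otimes\bar w$. Let $P$ be the poset of all nonzero complex subspaces $U\subseteq\mathbb{C}^{n+1}$ ordered by inclusion and topologised as the disjoint union of the Grassmannians, and consider the contravariant diagram $U\mapsto\mathcal{J}^{\mathbf R}(U\oplus V,W)$ on $P$, with maps given by restriction ($U\oplus V$ is the orthogonal sum). Its homotopy colimit $$\operatorname*{hocolim}_{0\ne U\subseteq\mathbb{C}^{n+1}}\mathcal{J}^{\mathbf R}(U\oplus V,W)$$ is taken over $P$ as a category object in spaces: it is the geometric realisation of the simplicial space whose $k$-simplices are the pairs $(G,z)$ of a chain $G(0)\supseteq G(1)\supseteq\dots\supseteq G(k)$ in $P$ and an isometry $z\in\mathcal{J}^{\mathbf R}(G(0)\oplus V,W)$, the space of pairs $(U,z)$ being topologised as the bundle of Stiefel manifolds over the Grassmannians; a monotone map $\theta$ acts by $(G,z)\mapsto(G\circ\theta, z|_{G(\theta(0))\oplus V})$. The group $C_2$ acts on it by $g\cdot[G,z,p]=[\overline{G},\,g\cdot z,\,p]$, where $\overline{G}(r)=\overline{G(r)}$, $(g\cdot z)(u,v)=\overline{z(\bar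 u,\bar v)}$ on $\overline{G(0)}\oplus V$, and $p\in\Delta^k$. Then there is a $C_2$-equivariant homeomorphism $$S\gamma^{\mathbf R}_{n+1}(V,W)\;\cong\;\operatorname*{hocolim}_{0\ne U\subseteq\mathbb{C}^{n+1}}\mathcal{J}^{\mathbf R}(U\oplus V,W).$$ -/

import Mathlib

open scoped TensorProduct

noncomputable section

namespace CalculusWithReality

/-! ### The group of order two and involutions -/

/-- The group with two elements. -/
abbrev C₂ : Type := Multiplicative (ZMod 2)

/-- The action of `C₂` on `X` whose non-identity element acts by the involution `τ`. -/
abbrev involutionAction {X : Type*} (τ : X → X) (hτ : Function.Involutive τ) :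
    MulAction C₂ X where
  smul g x := if g = 1 then x else τ x
  one_smul x := if_pos rfl
  mul_smul g h x := by
    change (if g * h = 1 then x else τ x) =
      if g = 1 then (if h = 1 then x else τ x) else τ (if h = 1 then x else τ x)
    have key : ∀ g h : C₂, g ≠ 1 → h ≠ 1 → g * h = 1 := by decide
    by_cases hg : g = 1
    · simp [hg]
    · by_cases hh : h = 1
      · simp [hg, hh]
      · simp [hg, hh, key g h hg hh, hτ x]

/-! ### Complex inner product spaces with a complex conjugation -/

/-- A complex conjugation on a complex inner product space: a conjugate-linear isometric
involution `v ↦ v̄`. In finite dimensions this is the same as writing the space as `ℂ ⊗ V'` for the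
real inner product space `V'` of fixed vectors, i.e. as having a basis of real vectors. -/
class RealStructure (V : Type*) [NormedAddCommGroup V] [InnerProductSpace ℂ V] where
  /-- complex conjugation -/
  conj : V ≃ₗᵢ⋆[ℂ] V
  conj_conj : ∀ v : V, conj (conj v) = v

/-- Complex conjugation. -/
abbrev conj {V : Type*} [NormedAddCommGroup V] [InnerProductSpace ℂ V] [RealStructure V] :
    V ≃ₗᵢ⋆[ℂ] V := RealStructure.conj

@[simp] theorem conj_conj {V : Type*} [NormedAddCommGroup V] [InnerProductSpace ℂ V]
    [RealStructure V] (v : V) : conj (conj v) = v := RealStructure.conj_conj v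

theorem inner_conj_conj {V : Type*} [NormedAddCommGroup V] [InnerProductSpace ℂ V]
    [RealStructure V] (v w : V) : inner ℂ (conj v) (conj w) = inner ℂ w v := by
  have h1 : ∀ a b : V, (inner ℂ (conj a) (conj b)).re = (inner ℂ a b).re := by
    intro a b
    have ha := norm_add_sq (𝕜 := ℂ) (conj a) (conj b)
    rw [← map_add, LinearIsometryEquiv.norm_map, LinearIsometryEquiv.norm_map,
      LinearIsometryEquiv.norm_map, norm_add_sq (𝕜 := ℂ) a b] at ha
    simp only [RCLike.re_to_complex] at ha
    linarith
  apply Complex.ext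
  · rw [h1, ← inner_conj_symm, Complex.conj_re]
  · have h2 := h1 (Complex.I • v) w
    rw [LinearIsometryEquiv.map_smulₛₗ, inner_smul_left, inner_smul_left] at h2
    rw [← inner_conj_symm w v, Complex.conj_im]
    simp at h2
    linarith

/-- The standard complex conjugation on `ℂᵐ`, coordinate by coordinate. -/
instance euclideanRealStructure (m : ℕ) : RealStructure (EuclideanSpace ℂ (Fin m)) where
  conj :=
    { toFun := fun v => WithLp.toLp 2 fun i => starRingEnd ℂ (v i)
      invFun := fun v => WithLp.toLp 2 fun i => starRingEnd ℂ (v i)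
      map_add' := fun v w => by ext i; simp
      map_smul' := fun c v => by ext i; simp
      left_inv := fun v => by ext i; simp
      right_inv := fun v => by ext i; simp
      norm_map' := fun v => by simp [EuclideanSpace.norm_eq] }
  conj_conj v := by
    ext i
    change starRingEnd ℂ (starRingEnd ℂ (v i)) = v i
    simp

/-! ### Spaces of linear isometries -/

section Isometries

variable {V W : Type*} [NormedAddCommGroup V] [InnerProductSpace ℂ V]
  [NormedAddCommGroup W] [InnerProductSpace ℂ W]

/-- The Stiefel topology on the set of complex linear isometries `V → W`. -/
instance isometryTopology : TopologicalSpace (V →ₗᵢ[ℂ] W) :=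
  TopologicalSpace.induced LinearIsometry.toContinuousLinearMap inferInstance

variable [RealStructure V] [RealStructure W]

/-- The action of the non-identity element of `C₂` on isometries: `(g f)(v) = conj (f (conj v))`. -/
def conjIsometry (f : V →ₗᵢ[ℂ] W) : V →ₗᵢ[ℂ] W :=
  (conj (V := W)).toLinearIsometry.comp (f.comp (conj (V := V)).toLinearIsometry)

@[simp] theorem conjIsometry_apply (f : V →ₗᵢ[ℂ] W) (v : V) :
    conjIsometry f v = conj (f (conj v)) := rfl

theorem conjIsometry_conjIsometry (f : V →ₗᵢ[ℂ] W) : conjIsometry (conjIsometry f) = f := by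
  ext v; simp

/-- Complex conjugation on `V ⊗ W`, with `conj (v ⊗ w) = conj v ⊗ conj w`. -/
def conjTensor : V ⊗[ℂ] W →ₛₗ[starRingEnd ℂ] V ⊗[ℂ] W :=
  TensorProduct.map (conj (V := V)).toLinearEquiv.toLinearMap
    (conj (V := W)).toLinearEquiv.toLinearMap

@[simp] theorem conjTensor_tmul (v : V) (w : W) :
    conjTensor (v ⊗ₜ[ℂ] w) = conj v ⊗ₜ[ℂ] conj w := rfl

theorem conjTensor_conjTensor (x : V ⊗[ℂ] W) : conjTensor (conjTensor x) = x := by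
  induction x with
  | zero => simp
  | tmul v w => simp
  | add x y hx hy => rw [map_add, map_add, hx, hy]

theorem inner_conjTensor (x y : V ⊗[ℂ] W) :
    inner ℂ (conjTensor x) (conjTensor y) = inner ℂ y x := by
  induction x with
  | zero => simp
  | add a b ha hb => rw [map_add, inner_add_left, ha, hb, inner_add_right]
  | tmul v w =>
    induction y with
    | zero => simp
    | add a b ha hb => rw [map_add, inner_add_right, ha, hb, inner_add_left]
    | tmul v' w' => simp [inner_conj_conj]

theorem norm_conjTensor (x : V ⊗[ℂ] W) : ‖conjTensor x‖ = ‖x‖ := by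
  rw [@norm_eq_sqrt_re_inner ℂ, inner_conjTensor]
  exact (norm_eq_sqrt_re_inner (𝕜 := ℂ) x).symm

end Isometries

/-! ### The complement bundles and their sphere bundles -/

section Bundle

variable (m : ℕ) (V W : Type*) [NormedAddCommGroup V] [InnerProductSpace ℂ V]
  [NormedAddCommGroup W] [InnerProductSpace ℂ W]

variable {V W} in
/-- The fibre `ℂᵐ ⊗ f(V)ᗮ` of the `m`-th complement bundle at `f`, as a subspace of `ℂᵐ ⊗ W`. -/
def complementFibre (f : V →ₗᵢ[ℂ] W) : Submodule ℂ (EuclideanSpace ℂ (Fin m) ⊗[ℂ] W) :=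
  LinearMap.range
    (LinearMap.lTensor (EuclideanSpace ℂ (Fin m)) (LinearMap.range f.toLinearMap)ᗮ.subtype)

/-- The total space `γ_m(V, W)` of the `m`-th complement bundle: pairs `(f, x)` with
`x ∈ ℂᵐ ⊗ f(V)ᗮ`, topologised as a subspace of the product with `ℂᵐ ⊗ W`. -/
abbrev ComplementBundle : Type _ :=
  {y : (V →ₗᵢ[ℂ] W) × (EuclideanSpace ℂ (Fin m) ⊗[ℂ] W) // y.2 ∈ complementFibre m y.1}

/-- The sphere bundle `Sγ_m(V, W)`: the unit vectors in the complement bundle. -/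
def SphereBundle : Type _ := {y : ComplementBundle m V W // ‖y.1.2‖ = 1}

instance : TopologicalSpace (SphereBundle m V W) :=
  inferInstanceAs (TopologicalSpace {y : ComplementBundle m V W // ‖y.1.2‖ = 1})

variable {V W}
variable [RealStructure V] [RealStructure W]

theorem conj_mem_orthogonal (f : V →ₗᵢ[ℂ] W) {w : W}
    (hw : w ∈ (LinearMap.range f.toLinearMap)ᗮ) :
    conj w ∈ (LinearMap.range (conjIsometry f).toLinearMap)ᗮ := by
  rw [Submodule.mem_orthogonal] at hw ⊢
  rintro _ ⟨v, rfl⟩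
  change inner ℂ (conj (f (conj v))) (conj w) = 0
  rw [inner_conj_conj, ← inner_conj_symm]
  exact (congrArg _ (hw _ ⟨conj v, rfl⟩)).trans (map_zero _)

theorem conjTensor_mem (f : V →ₗᵢ[ℂ] W) {x : EuclideanSpace ℂ (Fin m) ⊗[ℂ] W}
    (hx : x ∈ complementFibre m f) : conjTensor x ∈ complementFibre m (conjIsometry f) := by
  obtain ⟨y, rfl⟩ := hx
  induction y with
  | zero => simp
  | add a b ha hb => rw [map_add, map_add]; exact add_mem ha hb
  | tmul e w =>
    exact ⟨conj e ⊗ₜ ⟨conj (w : W), conj_mem_orthogonal f w.2⟩, rfl⟩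

/-- The action of the non-identity element of `C₂` on the sphere bundle, induced from the diagonal
action: `(f, x) ↦ (g f, conj x)`. -/
def SphereBundle.conj (y : SphereBundle m V W) : SphereBundle m V W :=
  ⟨⟨(conjIsometry y.1.1.1, conjTensor y.1.1.2), conjTensor_mem m _ y.1.2⟩,
    (norm_conjTensor _).trans y.2⟩

theorem SphereBundle.conj_involutive :
    Function.Involutive (SphereBundle.conj m : SphereBundle m V W → SphereBundle m V W) :=
  fun _ => Subtype.ext (Subtype.ext
    (Prod.ext (conjIsometry_conjIsometry _) (conjTensor_conjTensor _)))

instance : MulAction C₂ (SphereBundle m V W) :=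
  involutionAction (SphereBundle.conj m) (SphereBundle.conj_involutive m)

end Bundle

/-! ### Homotopy colimits over topological posets -/

universe u v

/-- A contravariant diagram of spaces on a topological poset `P` (a poset regarded as a category
object in spaces): the space `Total` of pairs `(p, z)` with `z` in the value at `p`, its projection
to `P`, and the restriction maps for `q ≤ p`, which are functorial and jointly continuous. -/
structure TopDiagram (P : Type u) [TopologicalSpace P] [PartialOrder P] where
  Total : Type v
  [topology : TopologicalSpace Total]
  base : Total → P
  continuous_base : Continuous base
  restrict : (z : Total) → (q : P) → q ≤ base z → Total
  base_restrict : ∀ z q h, base (restrict z q h) = q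
  restrict_self : ∀ z, restrict z (base z) le_rfl = z
  restrict_restrict : ∀ z q h q' (h' : q' ≤ base (restrict z q h)),
    restrict (restrict z q h) q' h' = restrict z q' (h'.trans ((base_restrict z q h).trans_le h))
  continuous_restrict :
    Continuous fun x : {x : Total × P // x.2 ≤ base x.1} => restrict x.1.1 x.1.2 x.2

attribute [instance] TopDiagram.topology

namespace TopDiagram

variable {P : Type u} [TopologicalSpace P] [PartialOrder P] (D : TopDiagram.{u, v} P)

/-- The space of `k`-simplices of the simplicial replacement of `D`: chains `G 0 ≥ ⋯ ≥ G k`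
in `P` together with a point in the value of `D` at `G 0`. -/
abbrev Simplex (k : ℕ) : Type _ :=
  {s : (Fin (k + 1) → P) × D.Total // Antitone s.1 ∧ D.base s.2 = s.1 0}

variable {D} in
/-- The simplicial operator of a monotone map `θ : [k] → [l]`: precompose the chain with `θ` and
restrict the point from `G 0` to `G (θ 0)`. -/
def Simplex.pull {k l : ℕ} (θ : Fin (k + 1) →o Fin (l + 1)) (s : D.Simplex l) : D.Simplex k :=
  ⟨(s.1.1 ∘ θ, D.restrict s.1.2 (s.1.1 (θ 0)) ((s.2.1 (Fin.zero_le _)).trans_eq s.2.2.symm)),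
    s.2.1.comp_monotone θ.monotone, D.base_restrict _ _ _⟩

/-- The disjoint union over `k` of the products of the space of `k`-simplices with `Δᵏ`. -/
abbrev PreHocolim : Type _ := Σ k : ℕ, D.Simplex k × stdSimplex ℝ (Fin (k + 1))

/-- The identifications `(θ^* s, p) ∼ (s, θ_* p)` of geometric realisation. -/
inductive Glue : D.PreHocolim → D.PreHocolim → Prop
  | glue {k l : ℕ} (θ : Fin (k + 1) →o Fin (l + 1)) (s : D.Simplex l)
      (p : stdSimplex ℝ (Fin (k + 1))) :
      Glue ⟨k, (s.pull θ, p)⟩ ⟨l, (s, stdSimplex.map θ p)⟩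

/-- The homotopy colimit of `D`: the geometric realisation of its simplicial replacement, with the
quotient topology. -/
def Hocolim : Type _ := Quot D.Glue

instance : TopologicalSpace D.Hocolim := inferInstanceAs (TopologicalSpace (Quot D.Glue))

/-- An involution of the diagram: compatible continuous involutions of the topological poset and
of the total space. -/
structure Involution where
  onBase : P → P
  onTotal : D.Total → D.Total
  continuous_onBase : Continuous onBase
  continuous_onTotal : Continuous onTotal
  monotone_onBase : Monotone onBase
  involutive_onBase : Function.Involutive onBase
  involutive_onTotal : Function.Involutive onTotal
  base_onTotal : ∀ z, D.base (onTotal z) = onBase (D.base z)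
  onTotal_restrict : ∀ z q h, onTotal (D.restrict z q h) =
    D.restrict (onTotal z) (onBase q) ((monotone_onBase h).trans_eq (base_onTotal z).symm)

variable {D} (τ : D.Involution)

/-- The induced map on `k`-simplices. -/
def Involution.onSimplex {k : ℕ} (s : D.Simplex k) : D.Simplex k :=
  ⟨(τ.onBase ∘ s.1.1, τ.onTotal s.1.2), τ.monotone_onBase.comp_antitone s.2.1,
    (τ.base_onTotal _).trans (congrArg τ.onBase s.2.2)⟩

theorem Involution.onSimplex_pull {k l : ℕ} (θ : Fin (k + 1) →o Fin (l + 1)) (s : D.Simplex l) :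
    τ.onSimplex (s.pull θ) = (τ.onSimplex s).pull θ :=
  Subtype.ext (Prod.ext rfl (τ.onTotal_restrict _ _ _))

theorem Involution.onSimplex_onSimplex {k : ℕ} (s : D.Simplex k) :
    τ.onSimplex (τ.onSimplex s) = s :=
  Subtype.ext (Prod.ext (funext fun _ => τ.involutive_onBase _) (τ.involutive_onTotal _))

/-- The induced map on the homotopy colimit, `[G, z, p] ↦ [τ G, τ z, p]`. -/
def Involution.onHocolim : D.Hocolim → D.Hocolim :=
  Quot.map (fun x => ⟨x.1, (τ.onSimplex x.2.1, x.2.2)⟩) (by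
    rintro _ _ ⟨θ, s, p⟩
    rw [τ.onSimplex_pull]
    exact Glue.glue θ (τ.onSimplex s) p)

theorem Involution.onHocolim_involutive : Function.Involutive τ.onHocolim := by
  rintro ⟨k, s, p⟩
  change Quot.mk D.Glue ⟨k, (τ.onSimplex (τ.onSimplex s), p)⟩ = Quot.mk D.Glue ⟨k, (s, p)⟩
  rw [τ.onSimplex_onSimplex]

end TopDiagram

/-! ### The diagram `U ↦ J(U ⊕ V, W)` on the nonzero subspaces of `ℂᵐ` -/

/-- The poset of nonzero complex subspaces of `ℂᵐ`, ordered by inclusion. -/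
abbrev NonzeroSubspace (m : ℕ) : Type :=
  {U : Submodule ℂ (EuclideanSpace ℂ (Fin m)) // U ≠ ⊥}

/-- The topology of the disjoint union of the Grassmannians: a subspace is identified with the
orthogonal projection onto it. -/
instance grassmannTopology (m : ℕ) : TopologicalSpace (NonzeroSubspace m) :=
  TopologicalSpace.induced (fun U => U.1.starProjection) inferInstance

/-- Complex conjugation of subspaces, `U ↦ {conj u | u ∈ U} = {u | conj u ∈ U}`. -/
def NonzeroSubspace.conj {m : ℕ} (U : NonzeroSubspace m) : NonzeroSubspace m :=
  ⟨U.1.comap (CalculusWithReality.conj (V := EuclideanSpace ℂ (Fin m))).toLinearEquiv.toLinearMap,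
    by
      obtain ⟨u, hu, hu0⟩ := (Submodule.ne_bot_iff _).1 U.2
      refine (Submodule.ne_bot_iff _).2 ⟨CalculusWithReality.conj u, ?_, ?_⟩
      · change CalculusWithReality.conj (CalculusWithReality.conj u) ∈ U.1
        rwa [conj_conj]
      · simpa using hu0⟩

theorem NonzeroSubspace.mem_conj {m : ℕ} (U : NonzeroSubspace m) (u : EuclideanSpace ℂ (Fin m)) :
    u ∈ U.conj.1 ↔ CalculusWithReality.conj u ∈ U.1 := Iff.rfl

theorem NonzeroSubspace.conj_involutive {m : ℕ} :
    Function.Involutive (NonzeroSubspace.conj (m := m)) := by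
  intro U
  ext u
  simp [NonzeroSubspace.mem_conj]

section Stiefel

variable (m : ℕ) (V W : Type*) [NormedAddCommGroup V] [InnerProductSpace ℂ V]
  [NormedAddCommGroup W] [InnerProductSpace ℂ W]

/-- Pairs of a nonzero subspace `U` of `ℂᵐ` and a linear isometry `U ⊕ V → W`, where `U ⊕ V`
is the orthogonal direct sum. -/
structure StiefelTotal where
  dom : NonzeroSubspace m
  iso : WithLp 2 (dom.1 × V) →ₗᵢ[ℂ] W

variable {m V W}

/-- The linear map `ℂᵐ ⊕ V → W` that extends an isometry on `U ⊕ V` by zero on `Uᗮ`. -/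
def StiefelTotal.extend (z : StiefelTotal m V W) :
    WithLp 2 (EuclideanSpace ℂ (Fin m) × V) →L[ℂ] W :=
  z.iso.toContinuousLinearMap ∘L
    (WithLp.prodContinuousLinearEquiv 2 ℂ z.dom.1 V).symm.toContinuousLinearMap ∘L
    (z.dom.1.orthogonalProjectionOnto.prodMap (ContinuousLinearMap.id ℂ V)) ∘L
    (WithLp.prodContinuousLinearEquiv 2 ℂ (EuclideanSpace ℂ (Fin m)) V).toContinuousLinearMap

/-- The topology of the bundle over the Grassmannians with fibre the Stiefel manifold of isometries
`U ⊕ V → W` at `U`: isometries on nearby subspaces are compared after extension by zero. -/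
instance : TopologicalSpace (StiefelTotal m V W) :=
  TopologicalSpace.induced (fun z => (z.dom, z.extend)) inferInstance

theorem StiefelTotal.extend_apply (z : StiefelTotal m V W) (u : EuclideanSpace ℂ (Fin m)) (v : V) :
    z.extend (WithLp.toLp 2 (u, v)) =
      z.iso (WithLp.toLp 2 (z.dom.1.orthogonalProjectionOnto u, v)) := rfl

theorem StiefelTotal.extend_coe (z : StiefelTotal m V W) (u : z.dom.1) (v : V) :
    z.extend (WithLp.toLp 2 ((u : EuclideanSpace ℂ (Fin m)), v)) = z.iso (WithLp.toLp 2 (u, v)) := by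
  rw [extend_apply]; simp

theorem StiefelTotal.ext_of {z z' : StiefelTotal m V W} (h : z.dom = z'.dom)
    (h' : ∀ (u : EuclideanSpace ℂ (Fin m)) (hu : u ∈ z.dom.1) (hu' : u ∈ z'.dom.1) (v : V),
      z.iso (WithLp.toLp 2 (⟨u, hu⟩, v)) = z'.iso (WithLp.toLp 2 (⟨u, hu'⟩, v))) : z = z' := by
  obtain ⟨U, f⟩ := z
  obtain ⟨U', f'⟩ := z'
  obtain rfl : U = U' := h
  congr 1
  ext ⟨⟨u, hu⟩, v⟩
  exact h' u hu hu v

/-- The inclusion `U' ⊕ V → U ⊕ V` for `U' ≤ U`. -/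
def sumInclusion {E : Type*} [NormedAddCommGroup E] [InnerProductSpace ℂ E]
    {U' U : Submodule ℂ E} (h : U' ≤ U) : WithLp 2 (U' × V) →ₗᵢ[ℂ] WithLp 2 (U × V) where
  toFun x := WithLp.toLp 2 (Submodule.inclusion h x.fst, x.snd)
  map_add' x y := rfl
  map_smul' c x := rfl
  norm_map' x := by
    rw [← sq_eq_sq₀ (norm_nonneg _) (norm_nonneg _), WithLp.prod_norm_sq_eq_of_L2,
      WithLp.prod_norm_sq_eq_of_L2]
    rfl

/-- Restriction of an isometry on `U ⊕ V` to `U' ⊕ V`. -/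
def StiefelTotal.restrict (z : StiefelTotal m V W) (U' : NonzeroSubspace m) (h : U' ≤ z.dom) :
    StiefelTotal m V W :=
  ⟨U', z.iso.comp (sumInclusion h)⟩

theorem StiefelTotal.extend_restrict (z : StiefelTotal m V W) (U' : NonzeroSubspace m)
    (h : U' ≤ z.dom) (x : WithLp 2 (EuclideanSpace ℂ (Fin m) × V)) :
    (z.restrict U' h).extend x = z.extend (WithLp.toLp 2 (U'.1.starProjection x.fst, x.snd)) :=
  (StiefelTotal.extend_coe z
    (Submodule.inclusion h (U'.1.orthogonalProjectionOnto x.fst)) x.snd).symm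

theorem StiefelTotal.continuous_dom :
    Continuous (StiefelTotal.dom : StiefelTotal m V W → NonzeroSubspace m) :=
  continuous_fst.comp (continuous_induced_dom (f := fun z : StiefelTotal m V W => (z.dom, z.extend)))

theorem StiefelTotal.continuous_extend :
    Continuous (StiefelTotal.extend : StiefelTotal m V W → _) :=
  continuous_snd.comp (continuous_induced_dom (f := fun z : StiefelTotal m V W => (z.dom, z.extend)))

theorem StiefelTotal.continuous_restrict :
    Continuous fun x : {x : StiefelTotal m V W × NonzeroSubspace m // x.2 ≤ x.1.dom} =>
      x.1.1.restrict x.1.2 x.2 := by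
  refine continuous_induced_rng.2 (Continuous.prodMk ?_ ?_)
  · exact continuous_snd.comp continuous_subtype_val
  · have h : ∀ x : {x : StiefelTotal m V W × NonzeroSubspace m // x.2 ≤ x.1.dom},
        (x.1.1.restrict x.1.2 x.2).extend = x.1.1.extend ∘L
          (WithLp.prodContinuousLinearEquiv 2 ℂ
            (EuclideanSpace ℂ (Fin m)) V).symm.toContinuousLinearMap ∘L
          (x.1.2.1.starProjection.prodMap (ContinuousLinearMap.id ℂ V)) ∘L
          (WithLp.prodContinuousLinearEquiv 2 ℂ
            (EuclideanSpace ℂ (Fin m)) V).toContinuousLinearMap := by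
      intro x
      ext y
      exact StiefelTotal.extend_restrict _ _ _ _
    change Continuous fun x : {x : StiefelTotal m V W × NonzeroSubspace m // x.2 ≤ x.1.dom} =>
      (x.1.1.restrict x.1.2 x.2).extend
    simp only [h]
    have h1 : Continuous fun x : {x : StiefelTotal m V W × NonzeroSubspace m // x.2 ≤ x.1.dom} =>
        x.1.1.extend :=
      StiefelTotal.continuous_extend.comp (continuous_fst.comp continuous_subtype_val)
    have h2 : Continuous fun x : {x : StiefelTotal m V W × NonzeroSubspace m // x.2 ≤ x.1.dom} =>
        x.1.2.1.starProjection :=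
      (continuous_induced_dom (f := fun U : NonzeroSubspace m => U.1.starProjection)).comp
        (continuous_snd.comp continuous_subtype_val)
    exact h1.clm_comp (continuous_const.clm_comp
      ((h2.prod_mapL ℂ continuous_const).clm_comp continuous_const))

variable (m V W) in
/-- The contravariant diagram `U ↦ J(U ⊕ V, W)` on the topological poset of nonzero subspaces
of `ℂᵐ`. -/
def stiefelDiagram : TopDiagram (NonzeroSubspace m) where
  Total := StiefelTotal m V W
  base := StiefelTotal.dom
  continuous_base := StiefelTotal.continuous_dom
  restrict := StiefelTotal.restrict
  base_restrict _ _ _ := rfl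
  restrict_self _ := rfl
  restrict_restrict _ _ _ _ _ := rfl
  continuous_restrict := StiefelTotal.continuous_restrict

variable [RealStructure V] [RealStructure W]

/-- The map `φ ⊕ conj : A ⊕ V → B ⊕ V`, for a conjugate-linear isometry `φ : A → B`. -/
def sumConj {A B : Type*} [NormedAddCommGroup A] [InnerProductSpace ℂ A]
    [NormedAddCommGroup B] [InnerProductSpace ℂ B] (φ : A →ₛₗᵢ[starRingEnd ℂ] B) :
    WithLp 2 (A × V) →ₛₗᵢ[starRingEnd ℂ] WithLp 2 (B × V) where
  toFun x := WithLp.toLp 2 (φ x.fst, conj x.snd)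
  map_add' x y := by
    simp [← WithLp.toLp_add]
  map_smul' c x := by
    simp [← WithLp.toLp_smul, LinearIsometry.map_smulₛₗ, LinearIsometryEquiv.map_smulₛₗ]
  norm_map' x := by
    rw [← sq_eq_sq₀ (norm_nonneg _) (norm_nonneg _), WithLp.prod_norm_sq_eq_of_L2,
      WithLp.prod_norm_sq_eq_of_L2, ← φ.norm_map x.fst, ← (conj (V := V)).norm_map x.snd]
    rfl

/-- Complex conjugation `Ū → U`. -/
def NonzeroSubspace.conjMap (U : NonzeroSubspace m) : U.conj.1 →ₛₗᵢ[starRingEnd ℂ] U.1 where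
  toFun u := ⟨CalculusWithReality.conj (u : EuclideanSpace ℂ (Fin m)), u.2⟩
  map_add' _ _ := Subtype.ext (map_add _ _ _)
  map_smul' _ _ := Subtype.ext (LinearIsometryEquiv.map_smulₛₗ _ _ _)
  norm_map' u := LinearIsometryEquiv.norm_map CalculusWithReality.conj (u : EuclideanSpace ℂ (Fin m))

/-- The action of the non-identity element of `C₂`: it takes an isometry `z : U ⊕ V → W` to the
isometry `Ū ⊕ V → W` with `(u, v) ↦ conj (z (conj u, conj v))`. -/
def StiefelTotal.conj (z : StiefelTotal m V W) : StiefelTotal m V W where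
  dom := z.dom.conj
  iso := (CalculusWithReality.conj (V := W)).toLinearIsometry.comp
    (z.iso.comp (sumConj (A := z.dom.conj.1) (B := z.dom.1) (V := V) z.dom.conjMap))

theorem NonzeroSubspace.starProjection_conj (U : NonzeroSubspace m)
    (u : EuclideanSpace ℂ (Fin m)) : U.conj.1.starProjection u =
      CalculusWithReality.conj (U.1.starProjection (CalculusWithReality.conj u)) := by
  refine Submodule.eq_starProjection_of_mem_of_inner_eq_zero ?_ fun w hw => ?_
  · rw [NonzeroSubspace.mem_conj, conj_conj]
    exact Submodule.starProjection_apply_mem _ _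
  · rw [← conj_conj u, ← conj_conj w, conj_conj (CalculusWithReality.conj u), ← map_sub,
      inner_conj_conj, ← inner_conj_symm]
    rw [Submodule.starProjection_inner_eq_zero _ _ ((U.mem_conj w).1 hw), map_zero]

theorem NonzeroSubspace.continuous_conj :
    Continuous (NonzeroSubspace.conj : NonzeroSubspace m → NonzeroSubspace m) := by
  refine continuous_induced_rng.2 ?_
  have h : ∀ U : NonzeroSubspace m, U.conj.1.starProjection =
      (CalculusWithReality.conj (V := EuclideanSpace ℂ (Fin m))
        ).toLinearIsometry.toContinuousLinearMap.comp
        (U.1.starProjection.comp (CalculusWithReality.conj (V := EuclideanSpace ℂ (Fin m))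
          ).toLinearIsometry.toContinuousLinearMap) := by
    intro U
    ext1 u
    exact U.starProjection_conj u
  change Continuous fun U : NonzeroSubspace m => U.conj.1.starProjection
  simp only [h]
  have h2 : Continuous fun U : NonzeroSubspace m => U.1.starProjection :=
    continuous_induced_dom (f := fun U : NonzeroSubspace m => U.1.starProjection)
  exact (ContinuousLinearMap.postcomp _ _).continuous.comp
    ((ContinuousLinearMap.precomp _ _).continuous.comp h2)

theorem StiefelTotal.extend_conj (z : StiefelTotal m V W)
    (x : WithLp 2 (EuclideanSpace ℂ (Fin m) × V)) :
    z.conj.extend x = CalculusWithReality.conj (z.extend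
      (sumConj (CalculusWithReality.conj (V := EuclideanSpace ℂ (Fin m))).toLinearIsometry x)) := by
  have h : z.dom.conjMap (z.dom.conj.1.orthogonalProjectionOnto x.fst) =
      z.dom.1.orthogonalProjectionOnto (CalculusWithReality.conj x.fst) := by
    apply Subtype.ext
    change CalculusWithReality.conj (z.dom.conj.1.starProjection x.fst) =
      z.dom.1.starProjection (CalculusWithReality.conj x.fst)
    rw [NonzeroSubspace.starProjection_conj, conj_conj]
  change CalculusWithReality.conj (z.iso (WithLp.toLp 2
    (z.dom.conjMap (z.dom.conj.1.orthogonalProjectionOnto x.fst), CalculusWithReality.conj x.snd))) = _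
  rw [h]
  rfl

theorem StiefelTotal.continuous_conj :
    Continuous (StiefelTotal.conj : StiefelTotal m V W → StiefelTotal m V W) := by
  refine continuous_induced_rng.2 (Continuous.prodMk ?_ ?_)
  · exact NonzeroSubspace.continuous_conj.comp StiefelTotal.continuous_dom
  · have h : ∀ z : StiefelTotal m V W, z.conj.extend =
        (CalculusWithReality.conj (V := W)).toLinearIsometry.toContinuousLinearMap.comp
        (z.extend.comp (sumConj (V := V) (CalculusWithReality.conj
          (V := EuclideanSpace ℂ (Fin m))).toLinearIsometry).toContinuousLinearMap) := by
      intro z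
      ext1 x
      exact z.extend_conj x
    change Continuous fun z : StiefelTotal m V W => z.conj.extend
    simp only [h]
    exact (ContinuousLinearMap.postcomp _ _).continuous.comp
      ((ContinuousLinearMap.precomp _ _).continuous.comp StiefelTotal.continuous_extend)

theorem StiefelTotal.conj_involutive :
    Function.Involutive (StiefelTotal.conj : StiefelTotal m V W → StiefelTotal m V W) := by
  intro z
  refine StiefelTotal.ext_of (NonzeroSubspace.conj_involutive _) fun u hu hu' v => ?_
  have hu2 : CalculusWithReality.conj (CalculusWithReality.conj u) ∈ z.dom.1 := by
    rwa [conj_conj]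
  have hc : (⟨CalculusWithReality.conj (CalculusWithReality.conj u), hu2⟩ : z.dom.1) = ⟨u, hu'⟩ :=
    Subtype.ext (conj_conj u)
  change CalculusWithReality.conj (CalculusWithReality.conj (z.iso (WithLp.toLp 2
    (⟨CalculusWithReality.conj (CalculusWithReality.conj u), hu2⟩,
      CalculusWithReality.conj (CalculusWithReality.conj v))))) = _
  rw [hc, conj_conj, conj_conj]

variable (m V W) in
/-- The involution of the diagram `U ↦ J(U ⊕ V, W)` given by complex conjugation. -/
def stiefelInvolution : (stiefelDiagram m V W).Involution where
  onBase := NonzeroSubspace.conj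
  onTotal := StiefelTotal.conj
  continuous_onBase := NonzeroSubspace.continuous_conj
  continuous_onTotal := StiefelTotal.continuous_conj
  monotone_onBase := fun _ _ h => Submodule.comap_mono h
  involutive_onBase := NonzeroSubspace.conj_involutive
  involutive_onTotal := StiefelTotal.conj_involutive
  base_onTotal _ := rfl
  onTotal_restrict _ _ _ := rfl

variable (m V W) in
/-- The homotopy colimit of `J(U ⊕ V, W)` over the topological poset of nonzero subspaces `U`
of `ℂᵐ`. -/
abbrev StiefelHocolim : Type _ := (stiefelDiagram m V W).Hocolim

instance : MulAction C₂ (StiefelHocolim m V W) :=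
  involutionAction _ (stiefelInvolution m V W).onHocolim_involutive

end Stiefel

end CalculusWithReality

end

noncomputable section

namespace CalculusWithReality

/-!
Fix `f : V → W`. The tensors `x ∈ ℂᵐ ⊗ f(V)ᗮ` are the linear maps `T : ℂᵐ → f(V)ᗮ`, and a radial
rescaling trades the Hilbert–Schmidt unit sphere for the operator norm unit sphere. A polar
decomposition `T = S |T|` consists of a positive operator `|T|` of norm one and an isometry `S`
on its range, which together with `f` is an isometry `z : range |T| ⊕ V → W`. By the spectral
theorem, a positive operator of norm one is uniquely `∑ i, pᵢ P_{G i}`, with orthogonal projections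
onto a strictly decreasing chain `G 0 > ⋯ > G k` of nonzero subspaces and positive weights of
sum one, and `G 0` is its range. So `(f, T)` is the same datum as a nondegenerate simplex `(G, z)`
of the homotopy colimit together with an interior point `p` of `Δᵏ`. The resulting bijection is
continuous from a compact space to a Hausdorff space.
-/

section FlagSum

variable {𝕜 E : Type*} [RCLike 𝕜] [NormedAddCommGroup E] [InnerProductSpace 𝕜 E]
  [FiniteDimensional 𝕜 E] {ι κ : Type*} [Fintype ι] [Fintype κ]

/-- The operator `∑ pᵢ Pᵢ`, where `Pᵢ` is the orthogonal projection onto `G i`. It is the positive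
operator that a point with barycentric coordinates `p` of a simplex with vertices `G` stands for. -/
def flagSum (G : ι → Submodule 𝕜 E) (p : ι → ℝ) : E →L[𝕜] E :=
  ∑ i, (p i : 𝕜) • (G i).starProjection

theorem flagSum_apply (G : ι → Submodule 𝕜 E) (p : ι → ℝ) (u : E) :
    flagSum G p u = ∑ i, (p i : 𝕜) • (G i).starProjection u := by
  simp [flagSum]

theorem flagSum_succ {k : ℕ} (G : Fin (k + 1) → Submodule 𝕜 E) (p : Fin (k + 1) → ℝ) :
    flagSum G p =
      (p 0 : 𝕜) • (G 0).starProjection + flagSum (Fin.tail G) (Fin.tail p) :=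
  Fin.sum_univ_succ _

theorem flagSum_map (G : κ → Submodule 𝕜 E) (θ : ι → κ) (p : stdSimplex ℝ ι) :
    flagSum G (stdSimplex.map θ p) = flagSum (G ∘ θ) p := by
  classical
  rw [flagSum, flagSum, ← Finset.sum_fiberwise Finset.univ θ]
  refine Finset.sum_congr rfl fun j _ => ?_
  rw [stdSimplex.map_coe, FunOnFinite.linearMap_apply_apply, RCLike.ofReal_sum, Finset.sum_smul]
  refine Finset.sum_congr (by congr) fun i hi => ?_
  obtain rfl := (Finset.mem_filter.1 hi).2
  rfl

theorem isPositive_flagSum (G : ι → Submodule 𝕜 E) {p : ι → ℝ} (hp : ∀ i, 0 ≤ p i) :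
    (flagSum G p).IsPositive :=
  have := FiniteDimensional.complete 𝕜 E
  ContinuousLinearMap.isPositive_sum _ fun i _ =>
    (ContinuousLinearMap.IsPositive.of_isStarProjection
      isStarProjection_starProjection).smul_of_nonneg (RCLike.ofReal_nonneg.2 (hp i))

theorem re_inner_flagSum_self (G : ι → Submodule 𝕜 E) (p : ι → ℝ) (u : E) :
    RCLike.re (inner 𝕜 (flagSum G p u) u) = ∑ i, p i * ‖(G i).starProjection u‖ ^ 2 := by
  rw [flagSum_apply, sum_inner, map_sum]
  refine Finset.sum_congr rfl fun i _ => ?_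
  rw [inner_smul_left, RCLike.conj_ofReal, RCLike.re_ofReal_mul,
    Submodule.re_inner_starProjection_eq_normSq, Submodule.starProjection_apply,
    Submodule.coe_norm]

theorem flagSum_apply_of_mem {G : ι → Submodule 𝕜 E} (p : ι → ℝ) {u : E} (hu : ∀ i, u ∈ G i) :
    flagSum G p u = ((∑ i, p i : ℝ) : 𝕜) • u := by
  rw [flagSum_apply, RCLike.ofReal_sum, Finset.sum_smul]
  exact Finset.sum_congr rfl fun i _ => by rw [Submodule.starProjection_eq_self_iff.2 (hu i)]

theorem norm_flagSum {G : ι → Submodule 𝕜 E} (hG : ⨅ i, G i ≠ ⊥) {p : ι → ℝ}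
    (hp : ∀ i, 0 ≤ p i) : ‖flagSum G p‖ = ∑ i, p i := by
  refine le_antisymm ?_ ?_
  · refine (norm_sum_le _ _).trans (Finset.sum_le_sum fun i _ => ?_)
    rw [norm_smul, RCLike.norm_ofReal, abs_of_nonneg (hp i)]
    exact mul_le_of_le_one_right (hp i) (Submodule.starProjection_norm_le _)
  · obtain ⟨u, hu, hu0⟩ := (Submodule.ne_bot_iff _).1 hG
    have h := (flagSum G p).le_opNorm u
    rw [flagSum_apply_of_mem p ((Submodule.mem_iInf _).1 hu), norm_smul, RCLike.norm_ofReal,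
      abs_of_nonneg (Finset.sum_nonneg fun i _ => hp i)] at h
    exact le_of_mul_le_mul_right h (norm_pos_iff.2 hu0)

theorem ker_flagSum (G : ι → Submodule 𝕜 E) {p : ι → ℝ} (hp : ∀ i, 0 < p i) :
    (flagSum G p).ker = (⨆ i, G i)ᗮ := by
  rw [← Submodule.iInf_orthogonal]
  ext u
  simp only [LinearMap.mem_ker, Submodule.mem_iInf, ContinuousLinearMap.coe_coe,
    ← Submodule.starProjection_apply_eq_zero_iff]
  refine ⟨fun hu i => ?_, fun hu => ?_⟩
  · have h := re_inner_flagSum_self G p u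
    rw [hu, inner_zero_left, map_zero, eq_comm, Finset.sum_eq_zero_iff_of_nonneg
      fun i _ => mul_nonneg (hp i).le (sq_nonneg _)] at h
    simpa [(hp i).ne'] using h i (Finset.mem_univ i)
  · simp [flagSum_apply, hu]

theorem range_flagSum (G : ι → Submodule 𝕜 E) {p : ι → ℝ} (hp : ∀ i, 0 < p i) :
    (flagSum G p).range = ⨆ i, G i := by
  rw [← Submodule.orthogonal_orthogonal (⨆ i, G i), ← ker_flagSum G hp,
    ← (isPositive_flagSum G fun i => (hp i).le).isSymmetric.orthogonal_range,
    Submodule.orthogonal_orthogonal]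

end FlagSum

section LeastEigenvalue

variable {𝕜 E : Type*} [RCLike 𝕜] [NormedAddCommGroup E] [InnerProductSpace 𝕜 E]

theorem eq_zero_of_mem_ker_of_mem_range {T : E →ₗ[𝕜] E} (hT : T.IsSymmetric) {v : E}
    (hker : v ∈ T.ker) (hrange : v ∈ T.range) : v = 0 := by
  rw [← hT.orthogonal_range] at hker
  exact Submodule.disjoint_def.1 (Submodule.orthogonal_disjoint T.range) v hrange hker

variable [FiniteDimensional 𝕜 E]

theorem exists_eigenvector_forall_mul_norm_sq_le [Nontrivial E] {T : E →ₗ[𝕜] E}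
    (hT : T.IsSymmetric) : ∃ (c : ℝ) (v : E), v ≠ 0 ∧ T v = (c : 𝕜) • v ∧
      ∀ w, c * ‖w‖ ^ 2 ≤ RCLike.re (inner 𝕜 (T w) w) := by
  obtain ⟨v, hv⟩ := hT.hasEigenvalue_iInf_of_finiteDimensional.exists_hasEigenvector
  refine ⟨_, v, hv.2, hv.apply_eq_smul, fun w => ?_⟩
  obtain rfl | hw := eq_or_ne w 0
  · simp
  rw [← le_div_iff₀ (pow_pos (norm_pos_iff.2 hw) 2)]
  refine ciInf_le ⟨-‖T.toContinuousLinearMap‖, ?_⟩ (⟨w, hw⟩ : {x : E // x ≠ 0})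
  rintro _ ⟨x, rfl⟩
  exact (abs_le.1 (T.toContinuousLinearMap.rayleighQuotient_le_norm x)).1

variable {A : E →L[𝕜] E}

theorem exists_eigenvector_mem_range (hA : A.IsPositive) (hA0 : A ≠ 0) :
    ∃ c > 0, ∃ v ∈ A.range, v ≠ 0 ∧ A v = ((c : ℝ) : 𝕜) • v ∧
      ∀ w ∈ A.range, c * ‖w‖ ^ 2 ≤ RCLike.re (inner 𝕜 (A w) w) := by
  have : Nontrivial A.range :=
    Submodule.nontrivial_iff_ne_bot.2 fun h =>
      hA0 (ContinuousLinearMap.coe_inj.1 (LinearMap.range_eq_bot.1 h))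
  have hinv : ∀ v ∈ A.range, A.toLinearMap v ∈ A.range := fun v _ => ⟨v, rfl⟩
  obtain ⟨c, v, hv0, hv, hc⟩ :=
    exists_eigenvector_forall_mul_norm_sq_le (hA.isSymmetric.restrict_invariant hinv)
  replace hv0 : (v : E) ≠ 0 := by simpa using hv0
  replace hv : A v = (c : 𝕜) • (v : E) := congrArg Subtype.val hv
  have hc_nonneg : 0 ≤ c * ‖(v : E)‖ ^ 2 := by
    have h := hA.re_inner_nonneg_left v
    rwa [hv, inner_smul_left, RCLike.conj_ofReal, RCLike.re_ofReal_mul, inner_self_eq_norm_sq] at h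
  have hc_ne : c ≠ 0 := by
    rintro rfl
    exact hv0 (eq_zero_of_mem_ker_of_mem_range hA.isSymmetric (by simpa using hv) v.2)
  exact ⟨c, (nonneg_of_mul_nonneg_left hc_nonneg (by positivity)).lt_of_ne' hc_ne,
    v, v.2, hv0, hv, fun w hw => hc ⟨w, hw⟩⟩

theorem inner_apply_starProjection_range (hA : A.toLinearMap.IsSymmetric) (w : E) :
    inner 𝕜 (A (A.range.starProjection w)) (A.range.starProjection w) = inner 𝕜 (A w) w := by
  have hPA : A.range.starProjection (A w) = A w :=
    Submodule.starProjection_eq_self_iff.2 ⟨w, rfl⟩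
  have hAP : A (A.range.starProjection w) = A w := by
    have h := Submodule.sub_starProjection_mem_orthogonal (K := A.range) w
    rw [hA.orthogonal_range, LinearMap.mem_ker, map_sub, sub_eq_zero] at h
    exact h.symm
  rw [hAP, ← Submodule.inner_starProjection_left_eq_right, hPA]

theorem exists_sub_smul_starProjection (hA : A.IsPositive) (hA0 : A ≠ 0) :
    ∃ c : ℝ, 0 < c ∧ (A - (c : 𝕜) • A.range.starProjection).IsPositive ∧
      (A - (c : 𝕜) • A.range.starProjection).range < A.range := by
  obtain ⟨c, hc, v, hv, hv0, hAv, hle⟩ := exists_eigenvector_mem_range hA hA0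
  set P := A.range.starProjection
  have hP : P.toLinearMap.IsSymmetric := A.range.starProjection_isSymmetric
  have hsymm : (A - (c : 𝕜) • P).toLinearMap.IsSymmetric :=
    hA.isSymmetric.sub (hP.smul (RCLike.conj_ofReal c))
  refine ⟨c, hc, ⟨hsymm, fun w => ?_⟩, lt_of_le_of_ne ?_ fun h => hv0 ?_⟩
  · have hP_sq : RCLike.re (inner 𝕜 (P w) w) = ‖P w‖ ^ 2 :=
      A.range.re_inner_starProjection_eq_normSq w
    rw [ContinuousLinearMap.reApplyInnerSelf_apply, sub_apply, smul_apply, inner_sub_left,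
      inner_smul_left, RCLike.conj_ofReal, map_sub, RCLike.re_ofReal_mul, hP_sq, sub_nonneg,
      ← inner_apply_starProjection_range hA.isSymmetric]
    exact hle _ (Submodule.starProjection_apply_mem _ w)
  · rintro _ ⟨w, rfl⟩
    exact sub_mem ⟨w, rfl⟩ (Submodule.smul_mem _ _ (Submodule.starProjection_apply_mem _ w))
  · refine eq_zero_of_mem_ker_of_mem_range hsymm (LinearMap.mem_ker.2 ?_) (h ▸ hv)
    change A v - (c : 𝕜) • P v = 0
    rw [Submodule.starProjection_eq_self_iff.2 hv, hAv, sub_self]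

end LeastEigenvalue

section WeightedFlag

variable {𝕜 E : Type*} [RCLike 𝕜] [NormedAddCommGroup E] [InnerProductSpace 𝕜 E]

/-- A strictly decreasing chain of nonzero subspaces with positive weights. Up to normalising the
weights, this is an interior point of a nondegenerate simplex of the nerve of the poset of nonzero
subspaces. -/
structure IsWeightedFlag {k : ℕ} (G : Fin k → Submodule 𝕜 E) (p : Fin k → ℝ) : Prop where
  strictAnti : StrictAnti G
  ne_bot : ∀ i, G i ≠ ⊥
  pos : ∀ i, 0 < p i

namespace IsWeightedFlag

variable {k l : ℕ}

theorem nil (G : Fin 0 → Submodule 𝕜 E) (p : Fin 0 → ℝ) : IsWeightedFlag G p :=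
  ⟨fun i => i.elim0, fun i => i.elim0, fun i => i.elim0⟩

theorem cons {G : Fin k → Submodule 𝕜 E} {p : Fin k → ℝ} (hG : IsWeightedFlag G p)
    {U : Submodule 𝕜 E} (hU : U ≠ ⊥) (hGU : ⨆ i, G i < U) {c : ℝ} (hc : 0 < c) :
    IsWeightedFlag (Fin.cons U G : Fin (k + 1) → Submodule 𝕜 E) (Fin.cons c p) where
  strictAnti := by
    refine Fin.cases (Fin.cases (fun h => absurd h (lt_irrefl _)) fun j _ => ?_) fun i =>
      Fin.cases (fun h => absurd h (Fin.not_lt_zero _)) fun j hij => ?_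
    · exact (le_iSup G j).trans_lt hGU
    · exact hG.strictAnti (Fin.succ_lt_succ_iff.1 hij)
  ne_bot := Fin.cases hU hG.ne_bot
  pos := Fin.cases hc hG.pos

section Tail

variable {G : Fin (k + 1) → Submodule 𝕜 E} {p : Fin (k + 1) → ℝ}

theorem tail (hG : IsWeightedFlag G p) : IsWeightedFlag (Fin.tail G) (Fin.tail p) :=
  ⟨hG.strictAnti.comp_strictMono Fin.strictMono_succ, fun _ => hG.ne_bot _, fun _ => hG.pos _⟩

theorem iSup_tail_lt (hG : IsWeightedFlag G p) : ⨆ i, Fin.tail G i < G 0 := by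
  cases k with
  | zero =>
    rw [iSup_of_empty]
    exact bot_lt_iff_ne_bot.2 (hG.ne_bot 0)
  | succ k =>
    have hle : ⨆ i, Fin.tail G i ≤ G 1 :=
      iSup_le fun i => hG.strictAnti.antitone (Fin.succ_le_succ_iff.2 (Fin.zero_le i))
    exact hle.trans_lt (hG.strictAnti (Fin.succ_pos 0))

theorem iSup_eq (hG : IsWeightedFlag G p) : ⨆ i, G i = G 0 :=
  le_antisymm (iSup_le fun i => hG.strictAnti.antitone (Fin.zero_le i)) (le_iSup G 0)

end Tail

end IsWeightedFlag

variable [FiniteDimensional 𝕜 E]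

theorem exists_isWeightedFlag_flagSum_eq {A : E →L[𝕜] E} (hA : A.IsPositive) :
    ∃ (k : ℕ) (G : Fin k → Submodule 𝕜 E) (p : Fin k → ℝ), IsWeightedFlag G p ∧
      flagSum G p = A := by
  induction hd : Module.finrank 𝕜 A.range using Nat.strong_induction_on generalizing A with
  | _ d ih =>
  by_cases hA0 : A = 0
  · exact ⟨0, Fin.elim0, Fin.elim0, .nil _ _, by simp [hA0, flagSum]⟩
  obtain ⟨c, hc, hpos, hlt⟩ := exists_sub_smul_starProjection hA hA0
  obtain ⟨k, G, p, hG, hGA⟩ := ih _ (hd ▸ Submodule.finrank_lt_finrank_of_lt hlt) hpos rfl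
  rw [← hGA, range_flagSum G hG.pos] at hlt
  exact ⟨k + 1, Fin.cons A.range G, Fin.cons c p, hG.cons (bot_le.trans_lt hlt).ne' hlt hc, by
    rw [flagSum_succ, Fin.tail_cons, Fin.tail_cons, Fin.cons_zero, Fin.cons_zero, hGA,
      add_sub_cancel]⟩

theorem le_of_smul_starProjection_add_eq {U : Submodule 𝕜 E} {B B' : E →L[𝕜] E}
    (hB : B.IsPositive) (hB' : B'.toLinearMap.IsSymmetric) (hlt : B'.range < U) {c c' : ℝ}
    (h : (c : 𝕜) • U.starProjection + B = (c' : 𝕜) • U.starProjection + B') : c ≤ c' := by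
  obtain ⟨v, ⟨hvB', hvU⟩, hv0⟩ : ∃ v ∈ B'.rangeᗮ ⊓ U, v ≠ 0 := by
    refine (Submodule.ne_bot_iff _).1 fun hbot => hlt.ne ?_
    simpa [hbot] using Submodule.sup_orthogonal_inf_of_hasOrthogonalProjection hlt.le
  have hv : (c : 𝕜) • v + B v = (c' : 𝕜) • v := by
    have hB'v : B' v = 0 := LinearMap.mem_ker.1 (hB'.orthogonal_range ▸ hvB')
    simpa [hB'v, Submodule.starProjection_eq_self_iff.2 hvU] using congrArg (· v) h
  have hinner : c * ‖v‖ ^ 2 + RCLike.re (inner 𝕜 (B v) v) = c' * ‖v‖ ^ 2 := by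
    have h' := congrArg (fun w => RCLike.re (inner 𝕜 w v)) hv
    simpa only [inner_add_left, inner_smul_left, RCLike.conj_ofReal, map_add, RCLike.re_ofReal_mul,
      inner_self_eq_norm_sq] using h'
  have hv_pos : 0 < ‖v‖ ^ 2 := pow_pos (norm_pos_iff.2 hv0) 2
  exact le_of_mul_le_mul_right (by linarith [hB.re_inner_nonneg_left v]) hv_pos

namespace IsWeightedFlag

variable {k l : ℕ}

theorem range_flagSum {G : Fin (k + 1) → Submodule 𝕜 E} {p : Fin (k + 1) → ℝ}
    (hG : IsWeightedFlag G p) : (flagSum G p).range = G 0 :=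
  (CalculusWithReality.range_flagSum G hG.pos).trans hG.iSup_eq

theorem flagSum_ne_zero {G : Fin (k + 1) → Submodule 𝕜 E} {p : Fin (k + 1) → ℝ}
    (hG : IsWeightedFlag G p) : flagSum G p ≠ 0 := fun h =>
  hG.ne_bot 0 (by simp [← hG.range_flagSum, h])

theorem weight_zero_le {G : Fin (k + 1) → Submodule 𝕜 E} {p : Fin (k + 1) → ℝ}
    {H : Fin (l + 1) → Submodule 𝕜 E} {q : Fin (l + 1) → ℝ} (hG : IsWeightedFlag G p)
    (hH : IsWeightedFlag H q) (h : flagSum G p = flagSum H q) : p 0 ≤ q 0 := by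
  have h0 : G 0 = H 0 := by rw [← hG.range_flagSum, h, hH.range_flagSum]
  rw [flagSum_succ, flagSum_succ, h0] at h
  refine le_of_smul_starProjection_add_eq (isPositive_flagSum _ fun i => (hG.pos _).le)
    (isPositive_flagSum _ fun i => (hH.pos _).le).isSymmetric ?_ h
  exact (CalculusWithReality.range_flagSum _ hH.tail.pos).trans_lt hH.iSup_tail_lt

theorem eq_of_flagSum_eq {G : Fin k → Submodule 𝕜 E} {p : Fin k → ℝ} {H : Fin l → Submodule 𝕜 E}
    {q : Fin l → ℝ} (hG : IsWeightedFlag G p) (hH : IsWeightedFlag H q)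
    (h : flagSum G p = flagSum H q) :
    ∃ e : k = l, G = H ∘ Fin.cast e ∧ p = q ∘ Fin.cast e := by
  induction k generalizing l with
  | zero =>
    cases l with
    | zero => exact ⟨rfl, Subsingleton.elim _ _, Subsingleton.elim _ _⟩
    | succ l => exact absurd h.symm (by simpa [flagSum] using hH.flagSum_ne_zero)
  | succ k ih =>
    cases l with
    | zero => exact absurd h (by simpa [flagSum] using hG.flagSum_ne_zero)
    | succ l =>
      have h0 : G 0 = H 0 := by rw [← hG.range_flagSum, h, hH.range_flagSum]
      have hpq : p 0 = q 0 := le_antisymm (hG.weight_zero_le hH h) (hH.weight_zero_le hG h.symm)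
      rw [flagSum_succ, flagSum_succ, h0, hpq, add_right_inj] at h
      obtain ⟨rfl, hG_tail, hp_tail⟩ := ih hG.tail hH.tail h
      exact ⟨rfl, funext (Fin.cases h0 (congrFun hG_tail)),
        funext (Fin.cases hpq (congrFun hp_tail))⟩

end IsWeightedFlag

end WeightedFlag

section PolarDecomposition

variable {E W : Type*} [NormedAddCommGroup E] [InnerProductSpace ℂ E] [CompleteSpace E]
  [NormedAddCommGroup W] [InnerProductSpace ℂ W]

theorem isPositive_ext_of_norm_apply_eq {A B : E →L[ℂ] E} (hA : A.IsPositive) (hB : B.IsPositive)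
    (h : ∀ u, ‖A u‖ = ‖B u‖) : A = B := by
  have hsq : A * A = B * B := by
    refine ContinuousLinearMap.coe_inj.1 ((ext_inner_map _ _).1 fun u => ?_)
    change inner ℂ (A (A u)) u = inner ℂ (B (B u)) u
    rw [hA.inner_left_eq_inner_right, hB.inner_left_eq_inner_right, inner_self_eq_norm_sq_to_K,
      inner_self_eq_norm_sq_to_K, h]
  rw [← CFC.sqrt_unique hsq ((ContinuousLinearMap.nonneg_iff_isPositive A).2 hA)]
  exact CFC.sqrt_unique rfl ((ContinuousLinearMap.nonneg_iff_isPositive B).2 hB)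

theorem exists_isPositive_norm_apply_eq [CompleteSpace W] (T : E →L[ℂ] W) :
    ∃ A : E →L[ℂ] E, A.IsPositive ∧ ∀ u, ‖A u‖ = ‖T u‖ := by
  have hT : 0 ≤ T.adjoint ∘L T := (ContinuousLinearMap.nonneg_iff_isPositive _).2
    (ContinuousLinearMap.isPositive_adjoint_comp_self T)
  have hsqrt : (CFC.sqrt (T.adjoint ∘L T)).IsPositive :=
    (ContinuousLinearMap.nonneg_iff_isPositive _).1 (CFC.sqrt_nonneg _)
  refine ⟨_, hsqrt, fun u => ?_⟩
  rw [← sq_eq_sq₀ (norm_nonneg _) (norm_nonneg _), ← inner_self_eq_norm_sq (𝕜 := ℂ),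
    ← inner_self_eq_norm_sq (𝕜 := ℂ), ← hsqrt.inner_left_eq_inner_right,
    ← mul_apply_eq_comp, CFC.sqrt_mul_sqrt_self _ hT, ContinuousLinearMap.comp_apply,
    ContinuousLinearMap.adjoint_inner_left]

end PolarDecomposition

section Factorization

variable {𝕜 E F W : Type*} [Ring 𝕜] [AddCommGroup E] [Module 𝕜 E]
  [SeminormedAddCommGroup F] [Module 𝕜 F] [NormedAddCommGroup W] [Module 𝕜 W]

theorem exists_linearIsometry_comp_eq {A : E →ₗ[𝕜] F} {T : E →ₗ[𝕜] W}
    (h : ∀ u, ‖A u‖ = ‖T u‖) :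
    ∃ S : A.range →ₗᵢ[𝕜] W, ∀ u, S (A.rangeRestrict u) = T u := by
  have hker : A.ker ≤ T.ker := fun u hu => by
    rw [LinearMap.mem_ker] at hu ⊢
    rw [← norm_eq_zero, ← h, hu, norm_zero]
  let S := (A.ker.liftQ T hker) ∘ₗ A.quotKerEquivRange.symm.toLinearMap
  have hS : ∀ u, S (A.rangeRestrict u) = T u := fun u =>
    congrArg (A.ker.liftQ T hker)
      (LinearMap.quotKerEquivRange_symm_apply_image A u (LinearMap.mem_range_self A u))
  refine ⟨⟨S, fun w => ?_⟩, hS⟩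
  obtain ⟨u, rfl⟩ := A.surjective_rangeRestrict w
  rw [hS, ← h]
  rfl

end Factorization

namespace TopDiagram

variable {P : Type*} [TopologicalSpace P] [PartialOrder P] {D : TopDiagram P} {k l : ℕ}

/-- The point `[G, z, p]` of the homotopy colimit, for the simplex `s = (G, z)`. -/
def Hocolim.mk (s : D.Simplex k) (p : stdSimplex ℝ (Fin (k + 1))) : D.Hocolim :=
  Quot.mk D.Glue ⟨k, (s, p)⟩

namespace Hocolim

theorem mk_pull (θ : Fin (k + 1) →o Fin (l + 1)) (s : D.Simplex l)
    (p : stdSimplex ℝ (Fin (k + 1))) : mk (s.pull θ) p = mk s (stdSimplex.map θ p) :=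
  Quot.sound (Glue.glue θ s p)

theorem exists_mk_eq (x : D.Hocolim) :
    ∃ (k : ℕ) (s : D.Simplex k) (p : stdSimplex ℝ (Fin (k + 1))), mk s p = x := by
  obtain ⟨⟨k, s, p⟩, rfl⟩ := Quot.exists_rep x
  exact ⟨k, s, p, rfl⟩

theorem continuous_mk :
    Continuous fun x : D.Simplex k × stdSimplex ℝ (Fin (k + 1)) => mk x.1 x.2 :=
  continuous_quot_mk.comp
    (continuous_sigmaMk (σ := fun k => D.Simplex k × stdSimplex ℝ (Fin (k + 1))))

end Hocolim

theorem restrict_of_eq (z : D.Total) (q : P) (h : q ≤ D.base z) (hq : q = D.base z) :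
    D.restrict z q h = z := by
  subst hq
  exact D.restrict_self z

theorem Simplex.pull_pull_eq (δ : Fin (k + 1) →o Fin (l + 1)) (σ : Fin (l + 1) →o Fin (k + 1))
    (s : D.Simplex l) (h : ∀ j, s.1.1 (δ (σ j)) = s.1.1 j) : (s.pull δ).pull σ = s := by
  refine Subtype.ext (Prod.ext (funext h) ?_)
  exact (D.restrict_restrict _ _ _ _ _).trans (restrict_of_eq _ _ _ ((h 0).trans s.2.2.symm))

theorem exists_map_succAbove_eq (p : stdSimplex ℝ (Fin (k + 2))) {j : Fin (k + 2)}
    (hj : p j = 0) : ∃ q : stdSimplex ℝ (Fin (k + 1)),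
      stdSimplex.map (Fin.succAboveOrderEmb j).toOrderHom q = p := by
  have hsum : ∑ i, p (j.succAbove i) = 1 := by
    have h := p.2.2
    rw [Fin.sum_univ_succAbove _ j] at h
    exact (zero_add _).symm.trans ((congrArg (· + _) hj.symm).trans h)
  refine ⟨⟨fun i => p (j.succAbove i), fun i => p.2.1 _, hsum⟩, ?_⟩
  ext i
  rw [stdSimplex.map_coe, FunOnFinite.linearMap_apply_apply]
  induction i using Fin.succAboveCases j with
  | x =>
    exact (Finset.sum_eq_zero fun a ha =>
      absurd (Finset.mem_filter.1 ha).2 (Fin.succAbove_ne j a)).trans hj.symm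
  | p i =>
    rw [Finset.sum_eq_single i]
    · rfl
    · exact fun b hb hbi =>
        absurd (Fin.succAbove_right_injective (Finset.mem_filter.1 hb).2) hbi
    · exact fun hi => (hi (Finset.mem_filter.2 ⟨Finset.mem_univ i, rfl⟩)).elim

theorem exists_mk_eq_of_weight_eq_zero (s : D.Simplex (k + 1)) (p : stdSimplex ℝ (Fin (k + 2)))
    {j : Fin (k + 2)} (hj : p j = 0) :
    ∃ (s' : D.Simplex k) (p' : stdSimplex ℝ (Fin (k + 1))), Hocolim.mk s' p' = Hocolim.mk s p := by
  obtain ⟨q, rfl⟩ := exists_map_succAbove_eq p hj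
  exact ⟨_, q, Hocolim.mk_pull _ s q⟩

theorem exists_mk_eq_of_vertex_eq (s : D.Simplex (k + 1)) (p : stdSimplex ℝ (Fin (k + 2)))
    {i : Fin (k + 1)} (hi : s.1.1 i.castSucc = s.1.1 i.succ) :
    ∃ (s' : D.Simplex k) (p' : stdSimplex ℝ (Fin (k + 1))), Hocolim.mk s' p' = Hocolim.mk s p := by
  have hpull : (s.pull (Fin.succAboveOrderEmb i.succ).toOrderHom).pull
      (Fin.predAboveOrderHom i) = s := by
    refine Simplex.pull_pull_eq _ _ s fun j => ?_
    change s.1.1 (i.succ.succAbove (i.predAbove j)) = _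
    by_cases hj : j = i.succ
    · rw [hj, Fin.predAbove_succ_self, Fin.succAbove_succ_self, hi]
    · rw [Fin.succ_succAbove_predAbove hj]
  refine ⟨s.pull (Fin.succAboveOrderEmb i.succ).toOrderHom,
    stdSimplex.map (Fin.predAboveOrderHom i) p, ?_⟩
  rw [← Hocolim.mk_pull, hpull]

theorem exists_nondegenerate (x : D.Hocolim) : ∃ (k : ℕ) (s : D.Simplex k)
    (p : stdSimplex ℝ (Fin (k + 1))), Hocolim.mk s p = x ∧ StrictAnti s.1.1 ∧ ∀ i, 0 < p i := by
  obtain ⟨k, s, p, rfl⟩ := Hocolim.exists_mk_eq x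
  induction k with
  | zero =>
    have : Unique (Fin (0 + 1)) := inferInstanceAs (Unique (Fin 1))
    refine ⟨0, s, p, rfl, Subsingleton.strictAnti _, fun i => ?_⟩
    rw [stdSimplex.eq_one_of_unique p i]
    exact one_pos
  | succ k ih =>
    by_cases hp : ∃ j, p j = 0
    · obtain ⟨j, hj⟩ := hp
      obtain ⟨s', p', h⟩ := exists_mk_eq_of_weight_eq_zero s p hj
      exact h ▸ ih s' p'
    by_cases hs : ∃ i : Fin (k + 1), s.1.1 i.castSucc = s.1.1 i.succ
    · obtain ⟨i, hi⟩ := hs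
      obtain ⟨s', p', h⟩ := exists_mk_eq_of_vertex_eq s p hi
      exact h ▸ ih s' p'
    push Not at hp hs
    exact ⟨k + 1, s, p, rfl, Fin.strictAnti_iff_succ_lt.2 fun i =>
      (s.2.1 i.castSucc_lt_succ.le).lt_of_ne' (hs i), fun i => (p.2.1 i).lt_of_ne' (hp i)⟩

section Compact

variable [CompactSpace P] [OrderClosedTopology P] [CompactSpace D.Total]

theorem compactSpace_simplex (k : ℕ) : CompactSpace (D.Simplex k) :=
  isCompact_iff_compactSpace.1 <| IsClosed.isCompact <|
    (isClosed_antitone.preimage continuous_fst).inter <|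
      isClosed_eq (D.continuous_base.comp continuous_snd) ((continuous_apply 0).comp continuous_fst)

theorem compactSpace_hocolim {m : ℕ}
    (hm : ∀ (k : ℕ) (G : Fin (k + 1) → P), StrictAnti G → k < m) : CompactSpace D.Hocolim := by
  have hcover : (Set.univ : Set D.Hocolim) = ⋃ k ∈ Finset.range m,
      Set.range fun x : D.Simplex k × stdSimplex ℝ (Fin (k + 1)) => Hocolim.mk x.1 x.2 := by
    refine (Set.eq_univ_of_forall fun x => ?_).symm
    obtain ⟨k, s, p, hx, hs, -⟩ := exists_nondegenerate x
    exact Set.mem_biUnion (Finset.mem_range.2 (hm k _ hs)) ⟨(s, p), hx⟩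
  rw [← isCompact_univ_iff, hcover]
  have := compactSpace_simplex (D := D)
  exact (Finset.range m).isCompact_biUnion fun k _ => isCompact_range Hocolim.continuous_mk

end Compact

end TopDiagram


section NormalizeEquiv

variable {X Y : Type*} [NormedAddCommGroup X] [NormedSpace ℝ X] [NormedAddCommGroup Y]
  [NormedSpace ℝ Y]

theorem continuousOn_normalize : ContinuousOn (NormedSpace.normalize : X → X) {0}ᶜ :=
  (continuous_norm.continuousOn.inv₀ fun _ hx => norm_ne_zero_iff.2 hx).smul continuousOn_id

theorem normalize_map_normalize_symm (L : X ≃ₗ[ℝ] Y) {y : Y} (hy : ‖y‖ = 1) :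
    NormedSpace.normalize (L (NormedSpace.normalize (L.symm y))) = y := by
  have hx : L.symm y ≠ 0 := L.symm.map_ne_zero_iff.2 (norm_ne_zero_iff.1 (hy ▸ one_ne_zero))
  have hL : L (NormedSpace.normalize (L.symm y)) = ‖L.symm y‖⁻¹ • y := by
    rw [NormedSpace.normalize, map_smul, L.apply_symm_apply]
  rw [hL, NormedSpace.normalize_smul_of_pos (inv_pos.2 (norm_pos_iff.2 hx)),
    NormedSpace.normalize_eq_self_of_norm_eq_one hy]

end NormalizeEquiv

section Tensor

variable (E W : Type*) [NormedAddCommGroup E] [InnerProductSpace ℂ E] [RealStructure E]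
  [FiniteDimensional ℂ E] [NormedAddCommGroup W] [InnerProductSpace ℂ W]

/-- The identification of `E ⊗ W` with the linear maps `E → W`, which sends `e ⊗ w` to
`u ↦ ⟪ē, u⟫ w`. The conjugation of `E` makes it complex linear. -/
def tensorEquivHom : E ⊗[ℂ] W ≃ₗ[ℂ] (E →L[ℂ] W) :=
  TensorProduct.congr (((conj (V := E)).toLinearEquiv.trans
      (InnerProductSpace.toDual ℂ E).toLinearEquiv).trans LinearMap.toContinuousLinearMap.symm)
      (LinearEquiv.refl ℂ W) ≪≫ₗ dualTensorHomEquiv ℂ E W ≪≫ₗ LinearMap.toContinuousLinearMap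

variable {E W}

@[simp] theorem tensorEquivHom_tmul (e : E) (w : W) (u : E) :
    tensorEquivHom E W (e ⊗ₜ w) u = inner ℂ (conj e) u • w := by
  simp [tensorEquivHom]

theorem tensorEquivHom_lTensor_subtype (S : Submodule ℂ W) (y : E ⊗[ℂ] S) (u : E) :
    tensorEquivHom E W (S.subtype.lTensor E y) u = tensorEquivHom E S y u := by
  induction y with
  | zero => simp
  | add a b ha hb => simp only [map_add, add_apply, ha, hb, Submodule.coe_add]
  | tmul e w => simp

theorem mem_range_lTensor_subtype_iff {S : Submodule ℂ W} {x : E ⊗[ℂ] W} :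
    x ∈ (S.subtype.lTensor E).range ↔ ∀ u, tensorEquivHom E W x u ∈ S := by
  constructor
  · rintro ⟨y, rfl⟩ u
    rw [tensorEquivHom_lTensor_subtype]
    exact Subtype.property _
  · intro h
    refine ⟨(tensorEquivHom E S).symm ((tensorEquivHom E W x).codRestrict S h),
      (tensorEquivHom E W).injective ?_⟩
    ext u
    rw [tensorEquivHom_lTensor_subtype, LinearEquiv.apply_symm_apply]
    rfl

theorem tensorEquivHom_conjTensor [RealStructure W] (x : E ⊗[ℂ] W) (u : E) :
    tensorEquivHom E W (conjTensor x) u = conj (tensorEquivHom E W x (conj u)) := by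
  induction x with
  | zero => simp
  | add a b ha hb => simp only [map_add, add_apply, ha, hb]
  | tmul e w =>
    rw [conjTensor_tmul, tensorEquivHom_tmul, tensorEquivHom_tmul, conj_conj,
      LinearIsometryEquiv.map_smulₛₗ, inner_conj_conj, inner_conj_symm]

/-- The unit vector in `E ⊗ W` in the direction of a nonzero linear map `E → W`. -/
def unitTensor (T : E →L[ℂ] W) : E ⊗[ℂ] W :=
  NormedSpace.normalize ((tensorEquivHom E W).symm T)

theorem norm_unitTensor {T : E →L[ℂ] W} (hT : T ≠ 0) : ‖unitTensor T‖ = 1 :=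
  NormedSpace.norm_normalize ((tensorEquivHom E W).symm.map_ne_zero_iff.2 hT)

theorem unitTensor_mem_range_lTensor_subtype {S : Submodule ℂ W} {T : E →L[ℂ] W}
    (hT : ∀ u, T u ∈ S) : unitTensor T ∈ (S.subtype.lTensor E).range := by
  refine Submodule.smul_of_tower_mem _ _ (mem_range_lTensor_subtype_iff.2 fun u => ?_)
  rw [LinearEquiv.apply_symm_apply]
  exact hT u

theorem normalize_tensorEquivHom_unitTensor {T : E →L[ℂ] W} (hT : ‖T‖ = 1) :
    NormedSpace.normalize (tensorEquivHom E W (unitTensor T)) = T :=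
  normalize_map_normalize_symm ((tensorEquivHom E W).restrictScalars ℝ) hT

theorem unitTensor_normalize_tensorEquivHom {x : E ⊗[ℂ] W} (hx : ‖x‖ = 1) :
    unitTensor (NormedSpace.normalize (tensorEquivHom E W x)) = x :=
  normalize_map_normalize_symm ((tensorEquivHom E W).symm.restrictScalars ℝ) hx

theorem continuousOn_unitTensor [FiniteDimensional ℂ W] :
    ContinuousOn (unitTensor : (E →L[ℂ] W) → E ⊗[ℂ] W) {0}ᶜ := by
  have h : Continuous (tensorEquivHom E W).symm :=
    LinearMap.continuous_of_finiteDimensional (tensorEquivHom E W).symm.toLinearMap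
  exact continuousOn_normalize.comp h.continuousOn fun T hT =>
    (tensorEquivHom E W).symm.map_ne_zero_iff.2 hT

theorem unitTensor_eq_conjTensor [RealStructure W] {S T : E →L[ℂ] W}
    (h : ∀ u, S u = conj (T (conj u))) : unitTensor S = conjTensor (unitTensor T) := by
  have hx : (tensorEquivHom E W).symm S = conjTensor ((tensorEquivHom E W).symm T) := by
    rw [LinearEquiv.symm_apply_eq]
    ext u
    rw [tensorEquivHom_conjTensor, LinearEquiv.apply_symm_apply, h]
  rw [unitTensor, unitTensor, hx, NormedSpace.normalize, NormedSpace.normalize, norm_conjTensor,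
    ← Complex.coe_smul, ← Complex.coe_smul, LinearMap.map_smulₛₗ, Complex.conj_ofReal]

end Tensor

theorem isClosed_setOf_isStarProjection {R : Type*} [TopologicalSpace R] [T2Space R] [Mul R]
    [Star R] [ContinuousMul R] [ContinuousStar R] : IsClosed {p : R | IsStarProjection p} := by
  simp only [isStarProjection_iff, IsIdempotentElem, isSelfAdjoint_iff]
  exact (isClosed_eq (continuous_id.mul continuous_id) continuous_id).inter
    (isClosed_eq continuous_star continuous_id)

namespace NonzeroSubspace

variable {m : ℕ}

theorem isInducing_starProjection :
    Topology.IsInducing fun U : NonzeroSubspace m => U.1.starProjection := ⟨rfl⟩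

theorem continuous_starProjection_apply (u : EuclideanSpace ℂ (Fin m)) :
    Continuous fun U : NonzeroSubspace m => U.1.starProjection u :=
  isInducing_starProjection.continuous.clm_apply continuous_const

theorem le_iff_starProjection {U U' : NonzeroSubspace m} :
    U ≤ U' ↔ ∀ u, U'.1.starProjection (U.1.starProjection u) = U.1.starProjection u := by
  simp only [Submodule.starProjection_eq_self_iff]
  refine ⟨fun h u => h (Submodule.starProjection_apply_mem _ _), fun h u hu => ?_⟩
  exact Submodule.starProjection_eq_self_iff.2 hu ▸ h u

instance : OrderClosedTopology (NonzeroSubspace m) where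
  isClosed_le' := by
    simp only [le_iff_starProjection, Set.ofPred_forall]
    have hfst (u : EuclideanSpace ℂ (Fin m)) := (continuous_starProjection_apply u).comp
      (continuous_fst (Y := NonzeroSubspace m))
    exact isClosed_iInter fun u => isClosed_eq
      ((isInducing_starProjection.continuous.comp continuous_snd).clm_apply (hfst u)) (hfst u)

theorem range_starProjection : Set.range (fun U : NonzeroSubspace m => U.1.starProjection) =
    Metric.sphere 0 1 ∩ {p | IsStarProjection p} := by
  ext p
  constructor
  · rintro ⟨U, rfl⟩
    exact ⟨mem_sphere_zero_iff_norm.2 (Submodule.norm_starProjection _ U.2),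
      isStarProjection_starProjection⟩
  · rintro ⟨hp1, hp⟩
    obtain ⟨U, _, rfl⟩ := isStarProjection_iff_eq_starProjection.1 hp
    refine ⟨⟨U, ?_⟩, rfl⟩
    rintro rfl
    simp at hp1

instance : CompactSpace (NonzeroSubspace m) := by
  have : ProperSpace (EuclideanSpace ℂ (Fin m) →L[ℂ] EuclideanSpace ℂ (Fin m)) :=
    FiniteDimensional.proper ℂ _
  rw [← isCompact_univ_iff, isInducing_starProjection.isCompact_iff, Set.image_univ,
    range_starProjection]
  exact (isCompact_sphere _ _).inter_right isClosed_setOf_isStarProjection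

theorem length_lt_of_strictAnti {k : ℕ} {G : Fin (k + 1) → NonzeroSubspace m}
    (hG : StrictAnti G) : k < m := by
  have hanti : StrictAnti fun i => Module.finrank ℂ (G i).1 := fun i j hij =>
    Submodule.finrank_lt_finrank_of_lt (hG hij)
  have hmem (i : Fin (k + 1)) : Module.finrank ℂ (G i).1 ∈ Finset.Icc 1 m :=
    Finset.mem_Icc.2 ⟨Submodule.one_le_finrank_iff.2 (G i).2,
      (Submodule.finrank_le _).trans_eq finrank_euclideanSpace_fin⟩
  simpa using Finset.card_le_card_of_injOn (s := Finset.univ) _ (fun i _ => hmem i)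
    hanti.injective.injOn

end NonzeroSubspace

namespace StiefelTotal

variable {m : ℕ} {V W : Type*} [NormedAddCommGroup V] [InnerProductSpace ℂ V]
  [NormedAddCommGroup W] [InnerProductSpace ℂ W]

theorem norm_extend_apply (z : StiefelTotal m V W) (u : EuclideanSpace ℂ (Fin m))
    (v : V) : ‖z.extend (WithLp.toLp 2 (u, v))‖ ^ 2 =
      ‖z.dom.1.starProjection u‖ ^ 2 + ‖v‖ ^ 2 := by
  rw [extend_apply, LinearIsometry.norm_map, WithLp.prod_norm_sq_eq_of_L2]
  rfl

theorem norm_extend_le (z : StiefelTotal m V W) : ‖z.extend‖ ≤ 1 := by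
  refine ContinuousLinearMap.opNorm_le_bound _ zero_le_one fun x => ?_
  rw [one_mul, ← sq_le_sq₀ (norm_nonneg _) (norm_nonneg _), WithLp.prod_norm_sq_eq_of_L2]
  refine (z.norm_extend_apply x.fst x.snd).trans_le ?_
  gcongr
  exact Submodule.norm_starProjection_apply_le _ _

theorem exists_eq_extend (U : NonzeroSubspace m)
    (T : WithLp 2 (EuclideanSpace ℂ (Fin m) × V) →L[ℂ] W)
    (hT : ∀ u v, ‖T (WithLp.toLp 2 (u, v))‖ ^ 2 = ‖U.1.starProjection u‖ ^ 2 + ‖v‖ ^ 2) :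
    ∃ z : StiefelTotal m V W, z.dom = U ∧ z.extend = T := by
  let f : WithLp 2 (U.1 × V) →ₗ[ℂ] W :=
    T.toLinearMap ∘ₗ (WithLp.linearEquiv 2 ℂ (EuclideanSpace ℂ (Fin m) × V)).symm.toLinearMap ∘ₗ
      U.1.subtype.prodMap LinearMap.id ∘ₗ (WithLp.linearEquiv 2 ℂ (U.1 × V)).toLinearMap
  have hf (x : WithLp 2 (U.1 × V)) : ‖f x‖ = ‖x‖ := by
    rw [← sq_eq_sq₀ (norm_nonneg _) (norm_nonneg _), WithLp.prod_norm_sq_eq_of_L2]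
    refine (hT x.fst x.snd).trans ?_
    rw [Submodule.starProjection_eq_self_iff.2 x.fst.2]
    rfl
  refine ⟨⟨U, f, hf⟩, rfl, ?_⟩
  ext ⟨u, v⟩
  -- `T` and the extension of `f` differ at `(u, v)` by `T (P u - u, 0)`, whose norm is
  -- `‖P (P u - u)‖ = 0`.
  change T (WithLp.toLp 2 (U.1.starProjection u, v)) = T (WithLp.toLp 2 (u, v))
  rw [← sub_eq_zero, ← map_sub, ← WithLp.toLp_sub, Prod.mk_sub_mk, sub_self,
    ← norm_eq_zero, ← sq_eq_zero_iff, hT, map_sub,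
    Submodule.starProjection_eq_self_iff.2 (Submodule.starProjection_apply_mem _ _)]
  simp

theorem range_dom_extend : Set.range (fun z : StiefelTotal m V W => (z.dom, z.extend)) =
    ⋂ u, ⋂ v, {x : NonzeroSubspace m × (WithLp 2 (EuclideanSpace ℂ (Fin m) × V) →L[ℂ] W) |
      ‖x.2 (WithLp.toLp 2 (u, v))‖ ^ 2 = ‖x.1.1.starProjection u‖ ^ 2 + ‖v‖ ^ 2} := by
  ext ⟨U, T⟩
  simp only [Set.mem_range, Prod.mk.injEq, Set.mem_iInter]
  constructor
  · rintro ⟨z, rfl, rfl⟩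
    exact z.norm_extend_apply
  · exact exists_eq_extend U T

theorem isClosed_range_dom_extend :
    IsClosed (Set.range fun z : StiefelTotal m V W => (z.dom, z.extend)) := by
  rw [range_dom_extend]
  refine isClosed_iInter fun u => isClosed_iInter fun v => isClosed_eq ?_ ?_
  · exact (continuous_snd.clm_apply continuous_const).norm.pow 2
  · exact (((NonzeroSubspace.continuous_starProjection_apply u).comp
      continuous_fst).norm.pow 2).add continuous_const

instance [FiniteDimensional ℂ V] [FiniteDimensional ℂ W] :
    CompactSpace (StiefelTotal m V W) := by
  have : ProperSpace (WithLp 2 (EuclideanSpace ℂ (Fin m) × V) →L[ℂ] W) :=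
    FiniteDimensional.proper ℂ (WithLp 2 (EuclideanSpace ℂ (Fin m) × V) →L[ℂ] W)
  have hind : Topology.IsInducing fun z : StiefelTotal m V W => (z.dom, z.extend) := ⟨rfl⟩
  rw [← isCompact_univ_iff, hind.isCompact_iff, Set.image_univ]
  have hball : IsCompact (Metric.closedBall
      (0 : WithLp 2 (EuclideanSpace ℂ (Fin m) × V) →L[ℂ] W) 1) := isCompact_closedBall _ _
  refine (isCompact_univ.prod hball).of_isClosed_subset isClosed_range_dom_extend ?_
  rintro _ ⟨z, rfl⟩
  exact ⟨trivial, (mem_closedBall_zero_iff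
    (E := WithLp 2 (EuclideanSpace ℂ (Fin m) × V) →L[ℂ] W)).2 z.norm_extend_le⟩

end StiefelTotal

instance {m : ℕ} {V W : Type*} [NormedAddCommGroup V] [InnerProductSpace ℂ V]
    [FiniteDimensional ℂ V] [NormedAddCommGroup W] [InnerProductSpace ℂ W]
    [FiniteDimensional ℂ W] : CompactSpace (StiefelHocolim m V W) := by
  have : CompactSpace (stiefelDiagram m V W).Total :=
    inferInstanceAs (CompactSpace (StiefelTotal m V W))
  exact TopDiagram.compactSpace_hocolim fun _ _ => NonzeroSubspace.length_lt_of_strictAnti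

namespace StiefelTotal

variable {m : ℕ} {V W : Type*} [NormedAddCommGroup V] [InnerProductSpace ℂ V]
  [NormedAddCommGroup W] [InnerProductSpace ℂ W]

/-- The restriction of an isometry `U ⊕ V → W` to `V`. -/
def restrictRight (z : StiefelTotal m V W) : V →ₗᵢ[ℂ] W where
  toFun v := z.extend (WithLp.toLp 2 (0, v))
  map_add' v w := by rw [← map_add, ← WithLp.toLp_add, Prod.mk_add_mk, add_zero]
  map_smul' c v := by rw [RingHom.id_apply, ← map_smul, ← WithLp.toLp_smul, Prod.smul_mk, smul_zero]
  norm_map' v := by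
    rw [← sq_eq_sq₀ (norm_nonneg _) (norm_nonneg _)]
    exact (z.norm_extend_apply 0 v).trans (by simp)

theorem restrictRight_apply (z : StiefelTotal m V W) (v : V) :
    z.restrictRight v = z.extend (WithLp.toLp 2 (0, v)) := rfl

/-- The restriction of an isometry `U ⊕ V → W` to `U`, extended by zero on `Uᗮ`. -/
def extendLeft (z : StiefelTotal m V W) : EuclideanSpace ℂ (Fin m) →L[ℂ] W :=
  z.extend ∘L (WithLp.prodContinuousLinearEquiv 2 ℂ
    (EuclideanSpace ℂ (Fin m)) V).symm.toContinuousLinearMap ∘L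
      ContinuousLinearMap.inl ℂ (EuclideanSpace ℂ (Fin m)) V

theorem extendLeft_apply (z : StiefelTotal m V W) (u : EuclideanSpace ℂ (Fin m)) :
    z.extendLeft u = z.extend (WithLp.toLp 2 (u, 0)) := rfl

theorem extendLeft_add_restrictRight (z : StiefelTotal m V W) (u : EuclideanSpace ℂ (Fin m))
    (v : V) : z.extendLeft u + z.restrictRight v = z.extend (WithLp.toLp 2 (u, v)) := by
  rw [extendLeft_apply, restrictRight_apply, ← map_add, ← WithLp.toLp_add, Prod.mk_add_mk,
    add_zero, zero_add]

theorem norm_extendLeft_apply (z : StiefelTotal m V W) {u : EuclideanSpace ℂ (Fin m)}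
    (hu : u ∈ z.dom.1) : ‖z.extendLeft u‖ = ‖u‖ := by
  rw [← sq_eq_sq₀ (norm_nonneg _) (norm_nonneg _)]
  refine (z.norm_extend_apply u 0).trans ?_
  rw [Submodule.starProjection_eq_self_iff.2 hu, norm_zero, zero_pow two_ne_zero, add_zero]

theorem extendLeft_mem_orthogonal (z : StiefelTotal m V W) (u : EuclideanSpace ℂ (Fin m)) :
    z.extendLeft u ∈ (LinearMap.range z.restrictRight.toLinearMap)ᗮ := by
  rw [Submodule.mem_orthogonal]
  rintro _ ⟨v, rfl⟩
  have h := LinearIsometry.inner_map_map (𝕜 := ℂ) (E := WithLp 2 (z.dom.1 × V)) z.iso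
    (WithLp.toLp 2 (z.dom.1.orthogonalProjectionOnto 0, v))
    (WithLp.toLp 2 (z.dom.1.orthogonalProjectionOnto u, 0))
  exact h.trans (by simp [WithLp.prod_inner_apply])

theorem ext_extendLeft_restrictRight {z z' : StiefelTotal m V W} (h : z.dom = z'.dom)
    (hl : ∀ u ∈ z.dom.1, z.extendLeft u = z'.extendLeft u)
    (hr : z.restrictRight = z'.restrictRight) : z = z' := by
  refine ext_of h fun u hu hu' v => ?_
  rw [← extend_coe, ← extend_coe, ← extendLeft_add_restrictRight, ← extendLeft_add_restrictRight,
    hl u hu, hr]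

theorem exists_extendLeft_eq_restrictRight_eq (U : NonzeroSubspace m) (S : U.1 →ₗᵢ[ℂ] W)
    (f : V →ₗᵢ[ℂ] W) (h : ∀ u, S u ∈ (LinearMap.range f.toLinearMap)ᗮ) :
    ∃ z : StiefelTotal m V W, z.dom = U ∧ (∀ u : U.1, z.extendLeft u = S u) ∧
      z.restrictRight = f := by
  let R : WithLp 2 (U.1 × V) →ₗ[ℂ] W :=
    S.toLinearMap.coprod f.toLinearMap ∘ₗ (WithLp.linearEquiv 2 ℂ (U.1 × V)).toLinearMap
  have hR (u : U.1) (v : V) : R (WithLp.toLp 2 (u, v)) = S u + f v := rfl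
  have hnorm (x : WithLp 2 (U.1 × V)) : ‖R x‖ = ‖x‖ := by
    have horth : inner ℂ (S x.fst) (f x.snd) = 0 :=
      (Submodule.mem_orthogonal' _ _).1 (h _) _ ⟨x.snd, rfl⟩
    rw [← sq_eq_sq₀ (norm_nonneg _) (norm_nonneg _), WithLp.prod_norm_sq_eq_of_L2,
      ← S.norm_map, ← f.norm_map, pow_two, pow_two, pow_two]
    exact norm_add_sq_eq_norm_sq_add_norm_sq_of_inner_eq_zero _ _ horth
  refine ⟨⟨U, R, hnorm⟩, rfl, fun u => ?_, LinearIsometry.ext fun v => ?_⟩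
  · rw [extendLeft_apply, extend_coe]
    exact (hR u 0).trans (by simp)
  · rw [restrictRight_apply, extend_apply, map_zero]
    exact (hR 0 v).trans (by simp)

theorem continuous_restrictRight :
    Continuous (restrictRight : StiefelTotal m V W → V →ₗᵢ[ℂ] W) := by
  have h : LinearIsometry.toContinuousLinearMap ∘ restrictRight =
      fun z : StiefelTotal m V W => z.extend ∘L ((WithLp.prodContinuousLinearEquiv 2 ℂ
        (EuclideanSpace ℂ (Fin m)) V).symm.toContinuousLinearMap ∘L
          ContinuousLinearMap.inr ℂ (EuclideanSpace ℂ (Fin m)) V) := rfl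
  rw [continuous_induced_rng, h]
  exact continuous_extend.clm_comp continuous_const

theorem continuous_extendLeft :
    Continuous (extendLeft : StiefelTotal m V W → EuclideanSpace ℂ (Fin m) →L[ℂ] W) :=
  continuous_extend.clm_comp continuous_const

theorem restrictRight_restrict (z : StiefelTotal m V W) (U : NonzeroSubspace m) (h : U ≤ z.dom) :
    (z.restrict U h).restrictRight = z.restrictRight := by
  ext v
  rw [restrictRight_apply, extend_restrict, restrictRight_apply]
  simp

theorem extendLeft_restrict (z : StiefelTotal m V W) (U : NonzeroSubspace m) (h : U ≤ z.dom)
    {u : EuclideanSpace ℂ (Fin m)} (hu : u ∈ U.1) :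
    (z.restrict U h).extendLeft u = z.extendLeft u := by
  rw [extendLeft_apply, extend_restrict, extendLeft_apply]
  simp [Submodule.starProjection_eq_self_iff.2 hu]

section Conj

variable [RealStructure V] [RealStructure W]

theorem restrictRight_conj (z : StiefelTotal m V W) :
    z.conj.restrictRight = conjIsometry z.restrictRight := by
  ext v
  rw [restrictRight_apply, extend_conj, conjIsometry_apply, restrictRight_apply]
  congr 2
  exact congrArg (fun a => WithLp.toLp 2 (a, _)) (map_zero _)

theorem extendLeft_conj (z : StiefelTotal m V W) (u : EuclideanSpace ℂ (Fin m)) :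
    z.conj.extendLeft u =
      CalculusWithReality.conj (z.extendLeft (CalculusWithReality.conj u)) := by
  rw [extendLeft_apply, extend_conj, extendLeft_apply]
  congr 2
  exact congrArg (fun a => WithLp.toLp 2 (_, a)) (map_zero _)

end Conj

end StiefelTotal

section SimplexMap

variable {m k l : ℕ} {V W : Type*} [NormedAddCommGroup V] [InnerProductSpace ℂ V]
  [NormedAddCommGroup W] [InnerProductSpace ℂ W]

/-- The chain of subspaces underlying a simplex. -/
def flag (s : (stiefelDiagram m V W).Simplex k) :
    Fin (k + 1) → Submodule ℂ (EuclideanSpace ℂ (Fin m)) := fun i => (s.1.1 i).1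

/-- The isometry `G 0 ⊕ V → W` underlying a simplex with chain `G`. -/
def frame (s : (stiefelDiagram m V W).Simplex k) : StiefelTotal m V W := s.1.2

theorem dom_frame (s : (stiefelDiagram m V W).Simplex k) : (frame s).dom.1 = flag s 0 :=
  congrArg Subtype.val s.2.2

theorem flag_antitone (s : (stiefelDiagram m V W).Simplex k) : Antitone (flag s) := s.2.1

theorem iInf_flag_ne_bot (s : (stiefelDiagram m V W).Simplex k) : ⨅ i, flag s i ≠ ⊥ :=
  ne_bot_of_le_ne_bot (s.1.1 (Fin.last k)).2 (le_iInf fun i => flag_antitone s i.le_last)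

theorem flagSum_flag_mem (s : (stiefelDiagram m V W).Simplex k) (p : Fin (k + 1) → ℝ)
    (u : EuclideanSpace ℂ (Fin m)) : flagSum (flag s) p u ∈ flag s 0 := by
  rw [flagSum_apply]
  exact Submodule.sum_mem _ fun i _ => Submodule.smul_mem _ _
    (flag_antitone s i.zero_le (Submodule.starProjection_apply_mem _ _))

theorem isWeightedFlag_flag {s : (stiefelDiagram m V W).Simplex k} (hs : StrictAnti s.1.1)
    {p : Fin (k + 1) → ℝ} (hp : ∀ i, 0 < p i) : IsWeightedFlag (flag s) p :=
  ⟨fun _ _ h => hs h, fun i => (s.1.1 i).2, hp⟩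

/-- The linear map `ℂᵐ → W` of operator norm one given by a point of a simplex. Its absolute value
is `flagSum (flag s) p`, and the isometry in its polar decomposition is the restriction of
`frame s` to the largest subspace of the chain. -/
def simplexMap (s : (stiefelDiagram m V W).Simplex k) (p : Fin (k + 1) → ℝ) :
    EuclideanSpace ℂ (Fin m) →L[ℂ] W :=
  (frame s).extendLeft ∘L flagSum (flag s) p

theorem simplexMap_apply (s : (stiefelDiagram m V W).Simplex k) (p : Fin (k + 1) → ℝ)
    (u : EuclideanSpace ℂ (Fin m)) :
    simplexMap s p u = (frame s).extendLeft (flagSum (flag s) p u) := rfl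

theorem norm_simplexMap_apply (s : (stiefelDiagram m V W).Simplex k) (p : Fin (k + 1) → ℝ)
    (u : EuclideanSpace ℂ (Fin m)) : ‖simplexMap s p u‖ = ‖flagSum (flag s) p u‖ :=
  (frame s).norm_extendLeft_apply (dom_frame s ▸ flagSum_flag_mem s p u)

theorem norm_simplexMap (s : (stiefelDiagram m V W).Simplex k)
    (p : stdSimplex ℝ (Fin (k + 1))) : ‖simplexMap s p‖ = 1 :=
  calc ‖simplexMap s p‖ = ‖flagSum (flag s) p‖ :=
        ContinuousLinearMap.opNorm_ext _ _ (norm_simplexMap_apply s p)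
    _ = ∑ i, p i := norm_flagSum (iInf_flag_ne_bot s) p.2.1
    _ = 1 := p.2.2

theorem simplexMap_ne_zero (s : (stiefelDiagram m V W).Simplex k)
    (p : stdSimplex ℝ (Fin (k + 1))) : simplexMap s p ≠ 0 :=
  norm_ne_zero_iff.1 (norm_simplexMap s p ▸ one_ne_zero)

theorem simplexMap_pull (θ : Fin (k + 1) →o Fin (l + 1)) (s : (stiefelDiagram m V W).Simplex l)
    (p : stdSimplex ℝ (Fin (k + 1))) :
    simplexMap (s.pull θ) p = simplexMap s (stdSimplex.map θ p) := by
  ext1 u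
  rw [simplexMap_apply, simplexMap_apply, flagSum_map]
  exact StiefelTotal.extendLeft_restrict _ _ _ (flagSum_flag_mem (s.pull θ) _ _)

theorem continuous_frame :
    Continuous (frame : (stiefelDiagram m V W).Simplex k → StiefelTotal m V W) :=
  continuous_snd.comp continuous_subtype_val

theorem continuous_simplexMap : Continuous
    fun x : (stiefelDiagram m V W).Simplex k × stdSimplex ℝ (Fin (k + 1)) =>
      simplexMap x.1 x.2 := by
  refine (StiefelTotal.continuous_extendLeft.comp
    (continuous_frame.comp continuous_fst)).clm_comp (continuous_finsetSum _ fun i _ => ?_)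
  have hweight : Continuous
      fun x : (stiefelDiagram m V W).Simplex k × stdSimplex ℝ (Fin (k + 1)) => x.2.1 i :=
    (continuous_apply i).comp (continuous_subtype_val.comp continuous_snd)
  have hvertex : Continuous
      fun x : (stiefelDiagram m V W).Simplex k × stdSimplex ℝ (Fin (k + 1)) => x.1.1.1 i :=
    (continuous_apply i).comp (continuous_fst.comp (continuous_subtype_val.comp continuous_fst))
  exact (Complex.continuous_ofReal.comp hweight).smul
    (NonzeroSubspace.isInducing_starProjection.continuous.comp hvertex)

theorem mk_eq_mk_of_simplexMap_eq {s : (stiefelDiagram m V W).Simplex k}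
    {p : stdSimplex ℝ (Fin (k + 1))} {t : (stiefelDiagram m V W).Simplex l}
    {q : stdSimplex ℝ (Fin (l + 1))} (hs : StrictAnti s.1.1) (hp : ∀ i, 0 < p i)
    (ht : StrictAnti t.1.1) (hq : ∀ i, 0 < q i)
    (hright : (frame s).restrictRight = (frame t).restrictRight)
    (hmap : simplexMap s p = simplexMap t q) :
    TopDiagram.Hocolim.mk s p = TopDiagram.Hocolim.mk t q := by
  have habs : flagSum (flag s) p = flagSum (flag t) q := by
    refine isPositive_ext_of_norm_apply_eq (isPositive_flagSum _ p.2.1)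
      (isPositive_flagSum _ q.2.1) fun u => ?_
    rw [← norm_simplexMap_apply, hmap, norm_simplexMap_apply]
  have hweighted := isWeightedFlag_flag hs hp
  obtain ⟨hlen, hflag, hweight⟩ :=
    hweighted.eq_of_flagSum_eq (isWeightedFlag_flag ht hq) habs
  obtain rfl : k = l := Nat.succ_injective hlen
  obtain rfl : p = q := Subtype.ext hweight
  have hframe : frame s = frame t := by
    refine StiefelTotal.ext_extendLeft_restrictRight (Subtype.ext ?_) (fun u hu => ?_) hright
    · rw [dom_frame, dom_frame]
      exact congrFun hflag 0
    · rw [dom_frame, ← hweighted.range_flagSum] at hu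
      obtain ⟨w, rfl⟩ := hu
      have h := DFunLike.congr_fun hmap w
      rw [simplexMap_apply, simplexMap_apply, ← habs] at h
      exact h
  obtain rfl : s = t :=
    Subtype.ext (Prod.ext (funext fun i => Subtype.ext (congrFun hflag i)) hframe)
  rfl

theorem exists_simplexMap_eq [FiniteDimensional ℂ W] (f : V →ₗᵢ[ℂ] W)
    {T : EuclideanSpace ℂ (Fin m) →L[ℂ] W} (hT : ‖T‖ = 1)
    (horth : ∀ u, T u ∈ (LinearMap.range f.toLinearMap)ᗮ) :
    ∃ (k : ℕ) (s : (stiefelDiagram m V W).Simplex k) (p : stdSimplex ℝ (Fin (k + 1))),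
      (frame s).restrictRight = f ∧ simplexMap s p = T := by
  have : CompleteSpace W := FiniteDimensional.complete ℂ W
  obtain ⟨A, hA, hAT⟩ := exists_isPositive_norm_apply_eq T
  have hA1 : ‖A‖ = 1 := (ContinuousLinearMap.opNorm_ext _ _ hAT).trans hT
  obtain ⟨S, hS⟩ := exists_linearIsometry_comp_eq (A := A.toLinearMap) (T := T.toLinearMap) hAT
  obtain ⟨k, G, p, hG, rfl⟩ := exists_isWeightedFlag_flagSum_eq hA
  cases k with
  | zero => simp [flagSum] at hA1
  | succ k =>
    have hrange := hG.range_flagSum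
    have hsum : ∑ i, p i = 1 := hA1 ▸ (norm_flagSum (ne_bot_of_le_ne_bot (hG.ne_bot (Fin.last k))
      (le_iInf fun i => hG.strictAnti.antitone i.le_last)) fun i => (hG.pos i).le).symm
    obtain ⟨z, hz, hzS, hzf⟩ := StiefelTotal.exists_extendLeft_eq_restrictRight_eq
      ⟨(flagSum G p).range, hrange.trans_ne (hG.ne_bot 0)⟩ S f <| by
        rintro ⟨_, u, rfl⟩
        exact (hS u).symm ▸ horth u
    refine ⟨k, ⟨(fun i => ⟨G i, hG.ne_bot i⟩, z), hG.strictAnti.antitone,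
      hz.trans (Subtype.ext hrange)⟩, ⟨p, fun i => (hG.pos i).le, hsum⟩, hzf, ?_⟩
    ext1 u
    exact (hzS ⟨_, u, rfl⟩).trans (hS u)

end SimplexMap

section Comparison

variable {m k l : ℕ} {V W : Type*} [NormedAddCommGroup V] [InnerProductSpace ℂ V]
  [NormedAddCommGroup W] [InnerProductSpace ℂ W]

theorem SphereBundle.ext {y y' : SphereBundle m V W} (hiso : y.1.1.1 = y'.1.1.1)
    (hvec : y.1.1.2 = y'.1.1.2) : y = y' :=
  Subtype.ext (Subtype.ext (Prod.ext hiso hvec))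

instance : T2Space (SphereBundle m V W) := by
  have : T2Space (V →ₗᵢ[ℂ] W) := T2Space.of_injective_continuous
    LinearIsometry.toContinuousLinearMap_injective continuous_induced_dom
  exact inferInstanceAs (T2Space {y : ComplementBundle m V W // ‖y.1.2‖ = 1})

/-- The point of the sphere bundle given by a point of a simplex. -/
def simplexToSphere (s : (stiefelDiagram m V W).Simplex k) (p : stdSimplex ℝ (Fin (k + 1))) :
    SphereBundle m V W :=
  ⟨⟨((frame s).restrictRight, unitTensor (simplexMap s p)),
    unitTensor_mem_range_lTensor_subtype fun _ => (frame s).extendLeft_mem_orthogonal _⟩,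
    norm_unitTensor (simplexMap_ne_zero s p)⟩

theorem simplexToSphere_pull (θ : Fin (k + 1) →o Fin (l + 1))
    (s : (stiefelDiagram m V W).Simplex l) (p : stdSimplex ℝ (Fin (k + 1))) :
    simplexToSphere (s.pull θ) p = simplexToSphere s (stdSimplex.map θ p) :=
  SphereBundle.ext (StiefelTotal.restrictRight_restrict _ _ _)
    (congrArg unitTensor (simplexMap_pull θ s p))

/-- The comparison map from the homotopy colimit to the sphere bundle. -/
def hocolimToSphere : StiefelHocolim m V W → SphereBundle m V W :=
  Quot.lift (fun x => simplexToSphere x.2.1 x.2.2) <| by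
    rintro _ _ ⟨θ, s, p⟩
    exact simplexToSphere_pull θ s p

theorem hocolimToSphere_mk (s : (stiefelDiagram m V W).Simplex k)
    (p : stdSimplex ℝ (Fin (k + 1))) :
    hocolimToSphere (TopDiagram.Hocolim.mk s p) = simplexToSphere s p := rfl

theorem continuous_hocolimToSphere [FiniteDimensional ℂ W] :
    Continuous (hocolimToSphere : StiefelHocolim m V W → SphereBundle m V W) := by
  refine continuous_quot_lift _ (continuous_sigma fun k => ?_)
  refine ((Continuous.prodMk ?_ ?_).subtype_mk _).subtype_mk _
  · exact StiefelTotal.continuous_restrictRight.comp (continuous_frame.comp continuous_fst)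
  · exact continuousOn_unitTensor.comp_continuous continuous_simplexMap
      fun x => simplexMap_ne_zero x.1 x.2

theorem hocolimToSphere_injective :
    Function.Injective (hocolimToSphere : StiefelHocolim m V W → SphereBundle m V W) := by
  intro x y hxy
  obtain ⟨k, s, p, rfl, hs, hp⟩ := TopDiagram.exists_nondegenerate x
  obtain ⟨l, t, q, rfl, ht, hq⟩ := TopDiagram.exists_nondegenerate y
  rw [hocolimToSphere_mk, hocolimToSphere_mk] at hxy
  have hright : (frame s).restrictRight = (frame t).restrictRight :=
    congrArg (fun y => y.1.1.1) hxy
  have hunit : unitTensor (simplexMap s p) = unitTensor (simplexMap t q) :=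
    congrArg (fun y => y.1.1.2) hxy
  refine mk_eq_mk_of_simplexMap_eq hs hp ht hq hright ?_
  rw [← normalize_tensorEquivHom_unitTensor (norm_simplexMap s p), hunit,
    normalize_tensorEquivHom_unitTensor (norm_simplexMap t q)]

theorem hocolimToSphere_surjective [FiniteDimensional ℂ W] :
    Function.Surjective (hocolimToSphere : StiefelHocolim m V W → SphereBundle m V W) := by
  rintro ⟨⟨⟨f, x⟩, hx⟩, hx1 : ‖x‖ = 1⟩
  have hne : tensorEquivHom (EuclideanSpace ℂ (Fin m)) W x ≠ 0 :=
    (LinearEquiv.map_ne_zero_iff _).2 (norm_ne_zero_iff.1 (hx1 ▸ one_ne_zero))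
  obtain ⟨k, s, p, hright, hmap⟩ := exists_simplexMap_eq f (NormedSpace.norm_normalize hne)
    fun u => Submodule.smul_of_tower_mem _ _ (mem_range_lTensor_subtype_iff.1 hx u)
  refine ⟨TopDiagram.Hocolim.mk s p, SphereBundle.ext hright ?_⟩
  exact (congrArg unitTensor hmap).trans (unitTensor_normalize_tensorEquivHom hx1)

variable (m V W) in
/-- The homeomorphism of the homotopy colimit with the sphere bundle: a continuous bijection from
a compact space to a Hausdorff space. -/
def hocolimHomeomorphSphere [FiniteDimensional ℂ V] [FiniteDimensional ℂ W] :
    StiefelHocolim m V W ≃ₜ SphereBundle m V W :=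
  Continuous.homeoOfEquivCompactToT2
    (f := Equiv.ofBijective hocolimToSphere ⟨hocolimToSphere_injective, hocolimToSphere_surjective⟩)
    continuous_hocolimToSphere

theorem coe_hocolimHomeomorphSphere [FiniteDimensional ℂ V] [FiniteDimensional ℂ W] :
    ⇑(hocolimHomeomorphSphere m V W) = hocolimToSphere := rfl

section Conj

variable [RealStructure V] [RealStructure W]

theorem flagSum_flag_onSimplex (s : (stiefelDiagram m V W).Simplex k) (p : Fin (k + 1) → ℝ)
    (u : EuclideanSpace ℂ (Fin m)) :
    flagSum (flag ((stiefelInvolution m V W).onSimplex s)) p u =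
      conj (flagSum (flag s) p (conj u)) := by
  rw [flagSum_apply, flagSum_apply, map_sum]
  refine Finset.sum_congr rfl fun i _ => ?_
  rw [LinearIsometryEquiv.map_smulₛₗ, RCLike.conj_ofReal]
  exact congrArg _ ((s.1.1 i).starProjection_conj u)

theorem simplexMap_onSimplex (s : (stiefelDiagram m V W).Simplex k) (p : Fin (k + 1) → ℝ)
    (u : EuclideanSpace ℂ (Fin m)) :
    simplexMap ((stiefelInvolution m V W).onSimplex s) p u = conj (simplexMap s p (conj u)) := by
  rw [simplexMap_apply, flagSum_flag_onSimplex]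
  refine ((frame s).extendLeft_conj _).trans ?_
  rw [conj_conj, simplexMap_apply]

theorem hocolimToSphere_onHocolim (x : StiefelHocolim m V W) :
    hocolimToSphere ((stiefelInvolution m V W).onHocolim x) =
      SphereBundle.conj m (hocolimToSphere x) := by
  obtain ⟨k, s, p, rfl⟩ := TopDiagram.Hocolim.exists_mk_eq x
  exact SphereBundle.ext (frame s).restrictRight_conj
    (unitTensor_eq_conjTensor (simplexMap_onSimplex s p))

theorem hocolimToSphere_smul (g : C₂) (x : StiefelHocolim m V W) :
    hocolimToSphere (g • x) = g • hocolimToSphere x := by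
  change hocolimToSphere (if g = 1 then x else (stiefelInvolution m V W).onHocolim x) =
    if g = 1 then hocolimToSphere x else SphereBundle.conj m (hocolimToSphere x)
  split_ifs
  · rfl
  · exact hocolimToSphere_onHocolim x

end Conj

end Comparison

end CalculusWithReality

end

theorem mainTheorem5 (n : ℕ)
    {V : Type*} [NormedAddCommGroup V] [InnerProductSpace ℂ V] [FiniteDimensional ℂ V]
    [CalculusWithReality.RealStructure V]
    {W : Type*} [NormedAddCommGroup W] [InnerProductSpace ℂ W] [FiniteDimensional ℂ W]
    [CalculusWithReality.RealStructure W] :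
    ∃ e : CalculusWithReality.SphereBundle (n + 1) V W ≃ₜ
        CalculusWithReality.StiefelHocolim (n + 1) V W,
      ∀ (g : CalculusWithReality.C₂) (y : CalculusWithReality.SphereBundle (n + 1) V W),
        e (g • y) = g • e y := by
  refine ⟨(CalculusWithReality.hocolimHomeomorphSphere (n + 1) V W).symm, fun g y => ?_⟩
  rw [Homeomorph.symm_apply_eq, CalculusWithReality.coe_hocolimHomeomorphSphere,
    CalculusWithReality.hocolimToSphere_smul, ← CalculusWithReality.coe_hocolimHomeomorphSphere,
    Homeomorph.apply_symm_apply]
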